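/- **Setting.** Let $X$ be a set, $\lambda\in\mathbb R$, let $\phi:X\to(-\infty,+\infty]$ be proper, i.e. $\mathscr D(\phi):=\{\phi<+\infty\}\neq\emptyset$, and let $c:X\times X\to\mathbb R$ be symmetric with $c\ge 0$ and $c(x,y)=0$ if and only if $x=y$. Let $\sigma$ be a Hausdorff topology on $X$ compatible with $(c,\phi)$: $\phi$ is $\sigma$-lower semicontinuous, $c$ is jointly $\sigma$-lower semicontinuous, and every net $(x_\alpha)$ contained in a sublevel $\{\phi\le r\}$, $r\in\mathbb R$, with $c(x_\alpha,x)\to0$ or $c(x,x_\alpha)\to 0$ for some $x\in X$ $\sigma$-converges to $x$. Put $E_\lambda(t):=\int_0^t e^{\lambda r}\,dr$. A curve $x:(0,+\infty)\to X$ belongs to $\mathrm{EVI}_\lambda(X,c,\phi)$ if $$e^{\lambda(t-s)}c(y,x_t)-c(y,x_s)\le E_\lambda(t-s)\,(\phi(y)-\phi(x_t))\qquad\forall\,0<s\le t,\ y\in\mathscr D(\phi).$$ Let $x\in\mathrm{EVI}_\lambda(X,c,\phi)$ and, if $\lambda<0$, assume in addition that $c$ is separately $\sigma$-continuous. Write $$|\dot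 x_{t+}|_c^2:=\lim_{h\downarrow0}\frac{2c(x_t,x_{t+h})}{h^2},\qquad |\partial\phi|_c(t;x):=\limsup_{h\downarrow0}\frac{(\phi(x_t)-\phi(x_{t+h}))^+}{\sqrt{2c(x_t,x_{t+h})}}\quad\Big(\text{with }\tfrac00:=0\Big),$$ and $|\dot x_{t+}|_c\ge 0$ for the square root of the former. **Theorem.** The following hold. 1. *$\lambda$-contraction.* For every $\tilde x\in\mathrm{EVI}_\lambda(X,c,\phi)$ and $0<s\le t$: $c(x_t,\tilde x_t)\le e^{-2\lambda(t-s)}c(x_s,\tilde x_s)$. 2. *Energy identity and regularizing effect.* For every $t>0$, $\phi(x_t)<+\infty$, the limit $|\dot x_{t+}|_c^2$ exists and is finite, and $t\mapsto\phi(x_t)$ has a right derivative at $t$, with $$\frac{d}{dt}\phi(x_{t+})=-|\dot x_{t+}|_c^2 .$$ The map $t\mapsto e^{2\lambda t}|\dot x_{t+}|_c^2$ is non-increasing on $(0,+\infty)$. The map $t\mapsto\phi(x_t)$ is continuous on $(0,+\infty)$; it is convex there if $\lambda\ge0$, and locally semiconvex if $\lambda<0$ (for every $[a,b]\subset(0,+\infty)$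 there is $K\ge0$ such that $t\mapsto\phi(x_t)+Kt^2$ is convex on $[a,b]$). It is differentiable outside a countable subset of $(0,+\infty)$. Moreover $|\dot x_{t+}|_c=|\partial\phi|_c(t;x)$ for every $t>0$. 3. *A priori estimate.* For every $y\in\mathscr D(\phi)$ and $0<s\le t$, $$e^{\lambda(t-s)}c(y,x_t)-c(y,x_s)+\frac{E_\lambda(t-s)^2}{2}|\dot x_{t+}|_c^2\le E_\lambda(t-s)\,(\phi(y)-\phi(x_t)).$$ 4. *Asymptotic behaviour.* Assume that $\phi$ is bounded from below. - If $\lambda>0$ and either (i) $\sigma$ is Cauchy-compatible with $(c,\phi)$, i.e. every sequence $(x_n)$ in a sublevel $\{\phi\le r\}$, $r\in\mathbb R$, such that for all $\varepsilon>0$ there is $N$ with $c(x_n,x_m)<\varepsilon$ for $n\ge m>N$ is $\sigma$-convergent, or (ii) the sublevel sets $\{\phi\le r\}$, $r\in\mathbb R$, are $\sigma$-compact sets, then $\phi$ has a unique minimum point $\bar x$, and for all $0<t_0<t$ $$\lambda c(\bar x,x_t)\le\phi(x_t)-\phi(\bar x)\le\frac{\lambda c(\bar x,x_{t_0})}{e^{\lambda(t-t_0)}-1},\qquad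 c(\bar x,x_t)\le c(\bar x,x_{t_0})e^{-2\lambda(t-t_0)} .$$ - If $\lambda=0$ and $\bar x$ is a minimizer of $\phi$, then $t\mapsto c(\bar x,x_t)$ is non-increasing on $(0,+\infty)$ and $\phi(x_t)-\phi(\bar x)\le\dfrac{c(\bar x,x_{t_0})}{t-t_0}$ for all $0<t_0<t$. - If $\lambda\ge0$ and $\bar x$ is a minimizer of $\phi$, then for all $0<t_0<t$ $$2\lambda(\phi(x_t)-\phi(\bar x))\le|\dot x_{t+}|_c^2,\qquad |\dot x_{t+}|_c\le|\dot x_{t_0+}|_c\,e^{-\lambda(t-t_0)},\qquad |\dot x_{t+}|_c\le\frac{\sqrt{2c(\bar x,x_{t_0})}}{E_\lambda(t-t_0)} .$$ - If $\lambda=0$, the sublevel sets $\{\phi\le r\}$, $r\in\mathbb R$, are $\sigma$-compact sets, and $c$ is jointly $\sigma$-continuous, then $x_t$ $\sigma$-converges to a minimizer of $\phi$ as $t\to+\infty$. -/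

import Mathlib

open Filter Topology Set

noncomputable section

namespace CostEVI

variable {X : Type*}

/-- A dissipative cost: `c ≥ 0`, and `c x y = 0` exactly on the diagonal. -/
structure IsDissipative (c : X → X → ℝ) : Prop where
  nonneg : ∀ x y, 0 ≤ c x y
  eq_zero_iff : ∀ x y, c x y = 0 ↔ x = y

/-- The topology of `X` is compatible with the pair `(c, φ)`. Convergence of nets is expressed with
filters: the tails of a net form a filter base, and every proper filter arises in this way. -/
structure IsCompatible [TopologicalSpace X] (c : X → X → ℝ) (φ : X → EReal) : Prop where
  hausdorff : T2Space X
  /-- `c`-convergent nets in sublevels of `φ` are convergent. -/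
  tendsto_of_cost : ∀ (r : ℝ) (F : Filter X) (x : X), (∀ᶠ y in F, φ y ≤ (r : EReal)) →
    (Tendsto (fun y => c y x) F (𝓝 0) ∨ Tendsto (fun y => c x y) F (𝓝 0)) → F ≤ 𝓝 x
  lsc_energy : LowerSemicontinuous φ
  lsc_cost : LowerSemicontinuous (fun p : X × X => c p.1 p.2)

/-- Compatibility, together with convergence of the `c`-(forward-)Cauchy sequences in sublevels. -/
structure IsCauchyCompatible [TopologicalSpace X] (c : X → X → ℝ) (φ : X → EReal) : Prop
    extends IsCompatible c φ where
  cauchy : ∀ (r : ℝ) (u : ℕ → X), (∀ n, φ (u n) ≤ (r : EReal)) →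
    (∀ ε > 0, ∃ N : ℕ, ∀ m n : ℕ, N < m → m ≤ n → c (u n) (u m) < ε) →
    ∃ x, Tendsto u atTop (𝓝 x)

/-- `c` is separately continuous. -/
def SeparatelyContinuous [TopologicalSpace X] (c : X → X → ℝ) : Prop :=
  (∀ x, Continuous (fun y => c x y)) ∧ (∀ y, Continuous (fun x => c x y))

/-- The sublevel sets of `φ` are compact. -/
def CompactSublevels [TopologicalSpace X] (φ : X → EReal) : Prop :=
  ∀ r : ℝ, IsCompact {y | φ y ≤ (r : EReal)}

/-- `x` is a minimum point of `φ`. -/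
def IsMinimizer (φ : X → EReal) (x : X) : Prop := ∀ y, φ x ≤ φ y

/-- `E_lam(t) = ∫₀ᵗ exp(lam * r) dr`. -/
def expInt (lam t : ℝ) : ℝ := ∫ r in (0 : ℝ)..t, Real.exp (lam * r)

/-- `x ∈ EVI_lam(X, c, φ)`: the EVI in exponential-integral form. A trajectory `(0, ∞) → X` is
represented by a function on `ℝ` whose values at times `t ≤ 0` are irrelevant. The inequality is
read in the extended reals: for `s < t` it forces `φ (x t) < ⊤` once `φ` is finite somewhere. -/
def IsEVI (lam : ℝ) (c : X → X → ℝ) (φ : X → EReal) (x : ℝ → X) : Prop :=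
  ∀ s t : ℝ, 0 < s → s ≤ t → ∀ y : X, φ y ≠ ⊤ →
    ((Real.exp (lam * (t - s)) * c y (x t) - c y (x s) : ℝ) : EReal)
      ≤ ((expInt lam (t - s) : ℝ) : EReal) * (φ y - φ (x t))

/-- The squared `c`-cost derivative of `x` at time `t` exists and equals the finite number `v`. -/
def HasCostDerivSq (c : X → X → ℝ) (x : ℝ → X) (t v : ℝ) : Prop :=
  Tendsto (fun h : ℝ => 2 * c (x t) (x (t + h)) / h ^ 2) (𝓝[>] 0) (𝓝 v)

/-- The value of the squared `c`-cost derivative (meaningful only when the limit exists). -/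
def costDerivSq (c : X → X → ℝ) (x : ℝ → X) (t : ℝ) : ℝ :=
  limUnder (𝓝[>] (0 : ℝ)) (fun h : ℝ => 2 * c (x t) (x (t + h)) / h ^ 2)

/-- The `c`-cost derivative, the nonnegative root of `costDerivSq`. -/
def costDeriv (c : X → X → ℝ) (x : ℝ → X) (t : ℝ) : ℝ := √(costDerivSq c x t)

/-- The oriented local slope of `φ` along `x` at time `t`, as an extended real. The quotient is read
as `0` when its denominator vanishes (for a dissipative cost `x (t + h) = x t` then). -/
def slopeAlong (c : X → X → ℝ) (φ : X → EReal) (x : ℝ → X) (t : ℝ) : EReal :=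
  limsup (fun h : ℝ =>
    max (φ (x t) - φ (x (t + h))) 0 / ((√(2 * c (x t) (x (t + h))) : ℝ) : EReal)) (𝓝[>] (0 : ℝ))

/-- The real-valued function `t ↦ φ (x t)`, used where `φ (x t)` is finite. -/
def energyAlong (φ : X → EReal) (x : ℝ → X) (t : ℝ) : ℝ := (φ (x t)).toReal

/-- `f` is locally semiconvex on `(0, ∞)`: on each compact subinterval it becomes convex after a
multiple of `t ^ 2` is added. -/
def LocallySemiconvexOnPos (f : ℝ → ℝ) : Prop :=
  ∀ a b : ℝ, 0 < a → a ≤ b → ∃ K : ℝ, 0 ≤ K ∧ ConvexOn ℝ (Icc a b) (fun t => f t + K * t ^ 2)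

end CostEVI

end

/-!
Write `f t = φ (x t)`, `E = expInt lam` and `τ = expInt (-2 * lam)`.

Summing the inequality over fine partitions of `[s, t]` (`le_of_forall_sub_le_mul_sub`) refines it to
`e^{λ(t-s)} c y (x t) - c y (x s) ≤ ∫ q in s..t, e^{λ(q-s)} (φ y - f q)` (`IsEVI.le_integral`). The
choice `y = x s` bounds `c (x s) (x t)` from above, the choice `y = x t` bounds it from below, and
eliminating the cost leaves an inequality for `f` alone: its exponentially weighted mean over
`[s, t]` is at most the corresponding weighted mean of its endpoint values
(`IsEVI.hermite_hadamard`). This is the Hermite-Hadamard inequality for the change of time `τ`,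
whose equality cases are the affine functions of `τ`. As `f` is continuous, it is a convex
function of `τ` (`intrinsicConvex_of_hermite_hadamard`).

Convexity in `τ` yields the regularity of `f`: the right derivative exists everywhere,
`e^{2λt} f'(t+)` is non-decreasing, and `f` is differentiable at the continuity points of this
monotone function. Inserting the first-order behaviour of `f` in the two bounds for `c (x s) (x t)`
identifies `-f'(t+)` with the squared cost derivative (`IsEVI.hasCostDerivSq`), and inserting the
convexity inequality in the integral form gives the a priori estimate.

The contraction comes from the partition argument applied to `e^{2λt} c (x t) (x' t)`: on each
subinterval one curve is tested with the final point of the other, then the other with the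
initial point of the first, so that the energies telescope (`IsEVI.contraction`). The cost is never
differentiated along the curves, and no continuity of it is required here.

If `λ ≥ 0`, the inequality with `y` fixed shows that `f` eventually drops below any value
above `φ y`, so the cluster points of the trajectory are minimizers
(`IsEVI.isMinimizer_of_mapClusterPt`); the remaining bounds test the inequality with a minimizer.
-/

namespace CostEVI

/-- Infinitesimal increments that telescope up to a factor `t - s` do not accumulate: sum them over
the partition of `[a, b]` into `n` equal parts and let `n → ∞`. -/
theorem le_of_forall_sub_le_mul_sub {u v : ℝ → ℝ} {a b : ℝ} (hab : a ≤ b)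
    (h : ∀ s t, a ≤ s → s ≤ t → t ≤ b → u t - u s ≤ (t - s) * (v s - v t)) : u b ≤ u a := by
  have key : ∀ n : ℕ, u b - u a ≤ (b - a) * (v a - v b) / (n + 1 : ℕ) := by
    intro n
    set N : ℕ := n + 1 with hN
    have hNpos : (0 : ℝ) < N := by positivity
    set d : ℝ := (b - a) / N with hd
    have hd0 : 0 ≤ d := div_nonneg (by linarith) hNpos.le
    have hdN : d * N = b - a := by rw [hd]; field_simp
    have step : ∀ k : ℕ, k ≤ N →
        u (a + k * d) - u a ≤ d * (v a - v (a + k * d)) := by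
      intro k
      induction k with
      | zero => simp
      | succ k ih =>
        intro hk
        have h1 := ih (by omega)
        have hk' : ((k + 1 : ℕ) : ℝ) ≤ N := by exact_mod_cast hk
        have h2 := h (a + k * d) (a + (k + 1 : ℕ) * d)
          (by have := mul_nonneg (Nat.cast_nonneg (α := ℝ) k) hd0; linarith)
          (by push_cast; linarith)
          (by have := mul_le_mul_of_nonneg_right hk' hd0; linarith)
        have h3 : a + ((k + 1 : ℕ) : ℝ) * d - (a + k * d) = d := by push_cast; ring
        rw [h3] at h2
        linarith
    have h4 := step N le_rfl
    have h5 : a + N * d = b := by linarith [mul_comm d (N : ℝ)]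
    rw [h5] at h4
    calc u b - u a ≤ d * (v a - v b) := h4
      _ = _ := by rw [hd]; ring
  have hlim : Tendsto (fun n : ℕ => (b - a) * (v a - v b) / (n + 1 : ℕ)) atTop (𝓝 0) :=
    (tendsto_const_div_atTop_nhds_zero_nat _).comp (tendsto_add_atTop_nat 1)
  have := ge_of_tendsto' hlim key
  linarith

/-! ### The exponential integral -/

theorem hasDerivAt_expInt (lam t : ℝ) : HasDerivAt (expInt lam) (Real.exp (lam * t)) t := by
  have hc : Continuous fun r : ℝ => Real.exp (lam * r) := by fun_prop
  exact intervalIntegral.integral_hasDerivAt_right (hc.intervalIntegrable _ _)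
    hc.aestronglyMeasurable.stronglyMeasurableAtFilter hc.continuousAt

theorem expInt_zero (lam : ℝ) : expInt lam 0 = 0 := by simp [expInt]

theorem expInt_zero_left (t : ℝ) : expInt 0 t = t := by simp [expInt]

theorem continuous_expInt (lam : ℝ) : Continuous (expInt lam) :=
  continuous_iff_continuousAt.2 fun t => (hasDerivAt_expInt lam t).continuousAt

theorem expInt_strictMono (lam : ℝ) : StrictMono (expInt lam) :=
  strictMono_of_deriv_pos fun t => by
    rw [(hasDerivAt_expInt lam t).deriv]; exact Real.exp_pos _

theorem expInt_nonneg (lam : ℝ) {t : ℝ} (ht : 0 ≤ t) : 0 ≤ expInt lam t := by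
  simpa [expInt_zero] using (expInt_strictMono lam).monotone ht

theorem expInt_pos (lam : ℝ) {t : ℝ} (ht : 0 < t) : 0 < expInt lam t := by
  simpa [expInt_zero] using expInt_strictMono lam ht

theorem integral_exp_mul_sub (lam s t : ℝ) :
    ∫ q in s..t, Real.exp (lam * (q - s)) = expInt lam (t - s) := by
  rw [expInt, intervalIntegral.integral_comp_sub_right (fun r => Real.exp (lam * r)) s, sub_self]

theorem mul_expInt (lam t : ℝ) : lam * expInt lam t = Real.exp (lam * t) - 1 := by
  simp [expInt]

theorem expInt_eq_div {lam : ℝ} (h : lam ≠ 0) (t : ℝ) :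
    expInt lam t = (Real.exp (lam * t) - 1) / lam := by
  rw [← mul_expInt]; field_simp

/-- On bounded time intervals `E_λ(t)` is at most a multiple of `t`. -/
theorem expInt_le_exp_mul (lam : ℝ) {t T : ℝ} (ht : 0 ≤ t) (hT : t ≤ T) :
    expInt lam t ≤ Real.exp (|lam| * T) * t := by
  have h1 : expInt lam t ≤ ∫ _ in (0 : ℝ)..t, Real.exp (|lam| * T) := by
    refine intervalIntegral.integral_mono_on ht
      ((by fun_prop : Continuous fun x => Real.exp (lam * x)).intervalIntegrable _ _)
      (by simp) fun x hx => Real.exp_le_exp.2 ?_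
    calc lam * x ≤ |lam| * x := mul_le_mul_of_nonneg_right (le_abs_self _) hx.1
      _ ≤ |lam| * T := mul_le_mul_of_nonneg_left (hx.2.trans hT) (abs_nonneg _)
  simpa [mul_comm] using h1

/-- The difference quotient of `E_λ` at `0` tends to `1`. -/
theorem tendsto_expInt_div (lam : ℝ) :
    Tendsto (fun h => expInt lam h / h) (𝓝[>] 0) (𝓝 1) := by
  have h1 := hasDerivAt_expInt lam 0
  have h2 := (hasDerivWithinAt_iff_tendsto_slope' (s := Ioi 0) (by simp)).1 h1.hasDerivWithinAt
  simp only [mul_zero, Real.exp_zero] at h2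
  refine h2.congr fun h => ?_
  simp [slope_def_field, expInt_zero]

theorem intervalIntegrable_exp_mul {lam : ℝ} {f : ℝ → ℝ} (hf : AntitoneOn f (Ioi 0))
    {s t : ℝ} (hs : 0 < s) (hst : s ≤ t) (r : ℝ) :
    IntervalIntegrable (fun q => Real.exp (lam * (q - r)) * f q) MeasureTheory.volume s t := by
  refine IntervalIntegrable.continuousOn_mul (AntitoneOn.intervalIntegrable (hf.mono ?_))
    (by fun_prop)
  rw [uIcc_of_le hst]
  exact fun q hq => hs.trans_le hq.1

theorem intervalIntegrable_exp {lam : ℝ} (s t r : ℝ) :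
    IntervalIntegrable (fun q => Real.exp (lam * (q - r))) MeasureTheory.volume s t :=
  (by fun_prop : Continuous fun q => Real.exp (lam * (q - r))).intervalIntegrable _ _

theorem integral_exp_mul_const_sub {lam : ℝ} {f : ℝ → ℝ} (hf : AntitoneOn f (Ioi 0))
    {s t : ℝ} (hs : 0 < s) (hst : s ≤ t) (k : ℝ) :
    ∫ q in s..t, Real.exp (lam * (q - s)) * (k - f q)
      = expInt lam (t - s) * k - ∫ q in s..t, Real.exp (lam * (q - s)) * f q := by
  simp_rw [mul_sub (Real.exp _)]
  rw [intervalIntegral.integral_sub ((intervalIntegrable_exp s t s).mul_const k)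
    (intervalIntegrable_exp_mul hf hs hst s), intervalIntegral.integral_mul_const,
    integral_exp_mul_sub]

/-- The increments of the intrinsic time `τ = E_{-2λ}`. -/
theorem expInt_neg_two_mul_sub (lam s t : ℝ) :
    expInt (-2 * lam) t - expInt (-2 * lam) s =
      Real.exp (-2 * lam * t) * expInt lam (t - s) * (Real.exp (lam * (t - s)) + 1) / 2 := by
  rcases eq_or_ne lam 0 with rfl | h
  · simp [expInt_zero_left]; ring
  · rw [expInt_eq_div (by simpa using h), expInt_eq_div (by simpa using h), expInt_eq_div h]
    have e1 : Real.exp (-2 * lam * s)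
        = Real.exp (-2 * lam * t) * Real.exp (lam * (t - s)) * Real.exp (lam * (t - s)) := by
      rw [← Real.exp_add, ← Real.exp_add]; ring_nf
    rw [e1]
    field_simp
    ring

/-- The exponential average of the intrinsic time over `[s, t]`. It makes `τ` an equality case of
the weighted Hermite-Hadamard inequality. -/
theorem integral_exp_mul_expInt_sub (lam s t : ℝ) :
    ∫ q in s..t, Real.exp (lam * (q - s)) * (expInt (-2 * lam) t - expInt (-2 * lam) q) =
      Real.exp (-2 * lam * t) * expInt lam (t - s) ^ 2 / 2 := by
  have hder : ∀ q ∈ uIcc s t, HasDerivAt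
      (fun q => -(Real.exp (-2 * lam * t) / 2) *
        ((expInt lam (t - s) - expInt lam (q - s)) * expInt lam (t - q)))
      (Real.exp (lam * (q - s)) * (expInt (-2 * lam) t - expInt (-2 * lam) q)) q := by
    intro q _
    have h1 := (hasDerivAt_expInt lam (q - s)).comp_sub_const q s
    have h2 := (hasDerivAt_expInt lam (t - q)).comp_const_sub t q
    refine (((h1.const_sub (expInt lam (t - s))).mul h2).const_mul _).congr_deriv ?_
    rw [expInt_neg_two_mul_sub]
    have h3 : expInt lam (t - s) - expInt lam (q - s)
        = Real.exp (lam * (q - s)) * expInt lam (t - q) := by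
      rcases eq_or_ne lam 0 with rfl | h
      · simp [expInt_zero_left]
      · rw [expInt_eq_div h, expInt_eq_div h, expInt_eq_div h]
        have : Real.exp (lam * (t - s)) = Real.exp (lam * (q - s)) * Real.exp (lam * (t - q)) := by
          rw [← Real.exp_add]; ring_nf
        rw [this]; field_simp; ring
    rw [h3]; ring
  have hcont : Continuous fun q =>
      Real.exp (lam * (q - s)) * (expInt (-2 * lam) t - expInt (-2 * lam) q) := by
    have := continuous_expInt (-2 * lam)
    fun_prop
  rw [intervalIntegral.integral_eq_sub_of_hasDerivAt hder (hcont.intervalIntegrable _ _)]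
  simp [expInt_zero]; ring

/-! ### Functions convex in the intrinsic time -/

/-- The slope of `f` between `s` and `t` with respect to the intrinsic time `τ = E_{-2λ}`. -/
noncomputable def intrinsicSlope (lam : ℝ) (f : ℝ → ℝ) (s t : ℝ) : ℝ :=
  (f t - f s) / (expInt (-2 * lam) t - expInt (-2 * lam) s)

/-- The right derivative of `f` at `t` with respect to the intrinsic time, for functions whose
intrinsic slopes are non-decreasing. -/
noncomputable def intrinsicDeriv (lam : ℝ) (f : ℝ → ℝ) (t : ℝ) : ℝ :=
  sInf (intrinsicSlope lam f t '' Ioi t)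

/-- `f` is convex on `(0, ∞)` as a function of the intrinsic time `τ = E_{-2λ}`, written as the
comparison of adjacent slopes. -/
def IntrinsicConvex (lam : ℝ) (f : ℝ → ℝ) : Prop :=
  ∀ s q t : ℝ, 0 < s → s < q → q < t → intrinsicSlope lam f s q ≤ intrinsicSlope lam f q t

theorem expInt_sub_pos (lam : ℝ) {s t : ℝ} (h : s < t) : 0 < expInt lam t - expInt lam s :=
  sub_pos.2 (expInt_strictMono lam h)

/-- A continuous function satisfying the exponentially weighted Hermite-Hadamard inequality is
convex in the intrinsic time: subtracting the chord, which is an equality case, one gets a function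
which cannot be positive between two consecutive points where it is nonpositive. -/
theorem intrinsicConvex_of_hermite_hadamard {lam : ℝ} {f : ℝ → ℝ} (hf : ContinuousOn f (Ioi 0))
    (h : ∀ s t : ℝ, 0 < s → s < t →
      (1 + Real.exp (lam * (t - s))) * ∫ q in s..t, Real.exp (lam * (q - s)) * f q
        ≤ expInt lam (t - s) * (Real.exp (lam * (t - s)) * f t + f s)) :
    IntrinsicConvex lam f := by
  intro s q t hs hsq hqt
  have hτc := continuous_expInt (-2 * lam)
  set τ := expInt (-2 * lam) with hτ
  -- `g` is `f` minus its chord, cleared of denominators.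
  set A : ℝ := τ t - τ s with hA
  set B : ℝ := f t - f s with hB
  set g : ℝ → ℝ := fun r => (f r - f s) * A - B * (τ r - τ s) with hg
  have hApos : 0 < A := expInt_sub_pos _ (hsq.trans hqt)
  have hgc : ContinuousOn g (Ioi 0) := by
    simp only [hg]; fun_prop
  have hIcc : ∀ {a b : ℝ}, 0 < a → Icc a b ⊆ Ioi 0 := fun ha r hr => lt_of_lt_of_le ha hr.1
  have hgHH : ∀ u v : ℝ, 0 < u → u < v →
      (1 + Real.exp (lam * (v - u))) * ∫ r in u..v, Real.exp (lam * (r - u)) * g r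
        ≤ expInt lam (v - u) * (Real.exp (lam * (v - u)) * g v + g u) := by
    intro u v hu huv
    have hfi : IntervalIntegrable (fun r => Real.exp (lam * (r - u)) * f r)
        MeasureTheory.volume u v := by
      apply ContinuousOn.intervalIntegrable
      rw [uIcc_of_le huv.le]
      have := hf.mono (hIcc hu (b := v))
      fun_prop
    have hei : IntervalIntegrable (fun r => Real.exp (lam * (r - u)))
        MeasureTheory.volume u v :=
      (by fun_prop : Continuous fun r => Real.exp (lam * (r - u))).intervalIntegrable _ _
    have hti : IntervalIntegrable (fun r => Real.exp (lam * (r - u)) * (τ v - τ r))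
        MeasureTheory.volume u v :=
      (by fun_prop : Continuous fun r => Real.exp (lam * (r - u)) * (τ v - τ r)).intervalIntegrable
        _ _
    have e1 : ∀ r, Real.exp (lam * (r - u)) * g r
        = A * (Real.exp (lam * (r - u)) * f r)
          + (-(A * f s) - B * (τ v - τ s)) * Real.exp (lam * (r - u))
          + B * (Real.exp (lam * (r - u)) * (τ v - τ r)) := by
      intro r; simp only [hg]; ring
    simp_rw [e1]
    rw [intervalIntegral.integral_add ((hfi.const_mul _).add (hei.const_mul _)) (hti.const_mul _),
      intervalIntegral.integral_add (hfi.const_mul _) (hei.const_mul _),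
      intervalIntegral.integral_const_mul, intervalIntegral.integral_const_mul,
      intervalIntegral.integral_const_mul, integral_exp_mul_sub, hτ, integral_exp_mul_expInt_sub,
      ← hτ]
    have e2 := expInt_neg_two_mul_sub lam u v
    rw [← hτ] at e2
    have e3 : τ u = τ v - Real.exp (-2 * lam * v) * expInt lam (v - u)
        * (Real.exp (lam * (v - u)) + 1) / 2 := by linarith
    have h1 := mul_le_mul_of_nonneg_left (h u v hu huv) hApos.le
    simp only [hg, e3]
    linear_combination h1
  have hgs : g s = 0 := by simp [hg]
  have hgt : g t = 0 := by simp [hg, hA, hB]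
  have hgq : g q ≤ 0 := by
    by_contra! hpos
    obtain ⟨u, ⟨⟨hu1, hu2⟩, hu3⟩, humax⟩ := IsCompact.exists_isGreatest
      (s := Icc s q ∩ g ⁻¹' Iic 0)
      (isCompact_Icc.of_isClosed_subset ((hgc.mono (hIcc hs)).preimage_isClosed_of_isClosed
        isClosed_Icc isClosed_Iic) inter_subset_left)
      ⟨s, ⟨le_rfl, hsq.le⟩, hgs.le⟩
    obtain ⟨v, ⟨⟨hv1, hv2⟩, hv3⟩, hvmin⟩ := IsCompact.exists_isLeast
      (s := Icc q t ∩ g ⁻¹' Iic 0)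
      (isCompact_Icc.of_isClosed_subset
        ((hgc.mono (hIcc (hs.trans hsq))).preimage_isClosed_of_isClosed isClosed_Icc isClosed_Iic) inter_subset_left)
      ⟨t, ⟨hqt.le, le_rfl⟩, hgt.le⟩
    simp only [mem_preimage, mem_Iic] at hu3 hv3
    have huq : u < q := lt_of_le_of_ne hu2 fun e => by rw [e] at hu3; linarith
    have hqv : q < v := lt_of_le_of_ne hv1 fun e => by rw [← e] at hv3; linarith
    have hu0 : 0 < u := hs.trans_le hu1
    have hint : 0 < ∫ r in u..v, Real.exp (lam * (r - u)) * g r := by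
      refine intervalIntegral.intervalIntegral_pos_of_pos_on ?_ (fun r hr => ?_) (huq.trans hqv)
      · apply ContinuousOn.intervalIntegrable
        rw [uIcc_of_le (huq.trans hqv).le]
        have := hgc.mono (hIcc hu0 (b := v))
        fun_prop
      · refine mul_pos (Real.exp_pos _) ?_
        by_contra! hr0
        rcases le_total r q with hrq | hrq
        · exact absurd (humax ⟨⟨hu1.trans hr.1.le, hrq⟩, hr0⟩) (not_le.2 hr.1)
        · exact absurd (hvmin ⟨⟨hrq, hr.2.le.trans hv2⟩, hr0⟩) (not_le.2 hr.2)
    have h1 := hgHH u v hu0 (huq.trans hqv)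
    have h2 : 0 < (1 + Real.exp (lam * (v - u))) *
        ∫ r in u..v, Real.exp (lam * (r - u)) * g r := by positivity
    have h3 : expInt lam (v - u) * (Real.exp (lam * (v - u)) * g v + g u) ≤ 0 := by
      refine mul_nonpos_of_nonneg_of_nonpos (expInt_nonneg _ (by linarith)) ?_
      have := mul_nonpos_of_nonneg_of_nonpos (Real.exp_pos (lam * (v - u))).le hv3
      linarith
    linarith
  rw [intrinsicSlope, intrinsicSlope, div_le_div_iff₀ (expInt_sub_pos _ hsq) (expInt_sub_pos _ hqt),
    ← hτ]
  simp only [hg, hA, hB] at hgq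
  linear_combination hgq

namespace IntrinsicConvex

variable {lam : ℝ} {f : ℝ → ℝ}

theorem slope_mul (f : ℝ → ℝ) (lam : ℝ) {s t : ℝ} (h : s < t) :
    f t - f s = intrinsicSlope lam f s t * (expInt (-2 * lam) t - expInt (-2 * lam) s) := by
  rw [intrinsicSlope, div_mul_cancel₀ _ (expInt_sub_pos _ h).ne']

/-- The slope over `[s, t]` lies between those over `[s, q]` and `[q, t]`. -/
theorem slope_mem_Icc (hf : IntrinsicConvex lam f) {s q t : ℝ} (hs : 0 < s) (hsq : s < q)
    (hqt : q < t) : intrinsicSlope lam f s t ∈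
      Icc (intrinsicSlope lam f s q) (intrinsicSlope lam f q t) := by
  have h1 := hf s q t hs hsq hqt
  have p1 := expInt_sub_pos (-2 * lam) hsq
  have p2 := expInt_sub_pos (-2 * lam) hqt
  have e1 := slope_mul f lam hsq
  have e2 := slope_mul f lam hqt
  have e3 := slope_mul f lam (hsq.trans hqt)
  have p3 := expInt_sub_pos (-2 * lam) (hsq.trans hqt)
  constructor
  · refine le_of_mul_le_mul_right ?_ p3
    nlinarith [mul_le_mul_of_nonneg_right h1 p2.le]
  · refine le_of_mul_le_mul_right ?_ p3
    nlinarith [mul_le_mul_of_nonneg_right h1 p1.le]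

theorem monotoneOn_slope (hf : IntrinsicConvex lam f) {t : ℝ} (ht : 0 < t) :
    MonotoneOn (intrinsicSlope lam f t) (Ioi t) := by
  intro p hp r _ hpr
  rcases hpr.eq_or_lt with rfl | hpr
  · rfl
  · exact (hf.slope_mem_Icc ht hp hpr).1

theorem bddBelow_slope (hf : IntrinsicConvex lam f) {t : ℝ} (ht : 0 < t) :
    BddBelow (intrinsicSlope lam f t '' Ioi t) := by
  refine ⟨intrinsicSlope lam f (t / 2) t, ?_⟩
  rintro _ ⟨r, hr, rfl⟩
  exact hf _ _ _ (by linarith) (by linarith) hr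

theorem tendsto_slope (hf : IntrinsicConvex lam f) {t : ℝ} (ht : 0 < t) :
    Tendsto (intrinsicSlope lam f t) (𝓝[>] t) (𝓝 (intrinsicDeriv lam f t)) :=
  (hf.monotoneOn_slope ht).tendsto_nhdsGT (hf.bddBelow_slope ht)

theorem deriv_le_slope (hf : IntrinsicConvex lam f) {s t : ℝ} (hs : 0 < s) (hst : s < t) :
    intrinsicDeriv lam f s ≤ intrinsicSlope lam f s t :=
  csInf_le (hf.bddBelow_slope hs) ⟨t, hst, rfl⟩

theorem slope_le_deriv (hf : IntrinsicConvex lam f) {s t : ℝ} (hs : 0 < s) (hst : s < t) :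
    intrinsicSlope lam f s t ≤ intrinsicDeriv lam f t := by
  refine le_csInf (nonempty_Ioi.image _) ?_
  rintro _ ⟨r, hr, rfl⟩
  exact hf _ _ _ hs hst hr

theorem monotoneOn_deriv (hf : IntrinsicConvex lam f) :
    MonotoneOn (intrinsicDeriv lam f) (Ioi 0) := by
  intro s hs t _ hst
  rcases hst.eq_or_lt with rfl | hst
  · rfl
  · exact (hf.deriv_le_slope hs hst).trans (hf.slope_le_deriv hs hst)

/-- The increment of `f` over `[s, t]` is bounded below through the derivative at `s`. -/
theorem deriv_mul_le_sub (hf : IntrinsicConvex lam f) {s t : ℝ} (hs : 0 < s) (hst : s ≤ t) :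
    intrinsicDeriv lam f s * (expInt (-2 * lam) t - expInt (-2 * lam) s) ≤ f t - f s := by
  rcases hst.eq_or_lt with rfl | hst
  · simp
  · rw [slope_mul f lam hst]
    exact mul_le_mul_of_nonneg_right (hf.deriv_le_slope hs hst) (expInt_sub_pos _ hst).le

/-- The increment of `f` over `[s, t]` is bounded above through the derivative at `t`. -/
theorem sub_le_deriv_mul (hf : IntrinsicConvex lam f) {s t : ℝ} (hs : 0 < s) (hst : s ≤ t) :
    f t - f s ≤ intrinsicDeriv lam f t * (expInt (-2 * lam) t - expInt (-2 * lam) s) := by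
  rcases hst.eq_or_lt with rfl | hst
  · simp
  · rw [slope_mul f lam hst]
    exact mul_le_mul_of_nonneg_right (hf.slope_le_deriv hs hst) (expInt_sub_pos _ hst).le

/-- Ordinary slopes are intrinsic slopes times the slopes of the intrinsic time. -/
theorem slope_eq_mul (f : ℝ → ℝ) (lam : ℝ) {s t : ℝ} (h : s < t) :
    slope f s t = intrinsicSlope lam f s t * slope (expInt (-2 * lam)) s t := by
  rw [slope_def_field, slope_def_field, slope_mul f lam h, mul_div_assoc]

theorem tendsto_slope_expInt (lam t : ℝ) :
    Tendsto (slope (expInt lam) t) (𝓝[≠] t) (𝓝 (Real.exp (lam * t))) :=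
  hasDerivAt_iff_tendsto_slope.1 (hasDerivAt_expInt lam t)

theorem hasDerivWithinAt (hf : IntrinsicConvex lam f) {t : ℝ} (ht : 0 < t) :
    HasDerivWithinAt f (intrinsicDeriv lam f t * Real.exp (-2 * lam * t)) (Ioi t) t := by
  rw [hasDerivWithinAt_iff_tendsto_slope' (by simp)]
  refine ((hf.tendsto_slope ht).mul ((tendsto_slope_expInt (-2 * lam) t).mono_left
    (nhdsGT_le_nhdsNE t))).congr' ?_
  filter_upwards [self_mem_nhdsWithin] with r hr
  exact (slope_eq_mul f lam hr).symm

theorem differentiableAt (hf : IntrinsicConvex lam f) {t : ℝ} (ht : 0 < t)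
    (hc : ContinuousWithinAt (intrinsicDeriv lam f) (Ioi 0) t) : DifferentiableAt ℝ f t := by
  refine HasDerivAt.differentiableAt (f' := intrinsicDeriv lam f t * Real.exp (-2 * lam * t)) ?_
  rw [hasDerivAt_iff_tendsto_slope_left_right]
  refine ⟨?_, (hasDerivWithinAt_iff_tendsto_slope' (by simp)).1 (hf.hasDerivWithinAt ht)⟩
  have hev : ∀ᶠ s in 𝓝[<] t, s ∈ Ioo 0 t := Ioo_mem_nhdsLT ht
  have hl : Tendsto (fun s => intrinsicSlope lam f s t) (𝓝[<] t) (𝓝 (intrinsicDeriv lam f t)) := by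
    have hc' : Tendsto (intrinsicDeriv lam f) (𝓝[<] t) (𝓝 (intrinsicDeriv lam f t)) :=
      (hc.continuousAt (Ioi_mem_nhds ht)).tendsto.mono_left nhdsWithin_le_nhds
    refine tendsto_of_tendsto_of_tendsto_of_le_of_le' hc' tendsto_const_nhds ?_ ?_
    · filter_upwards [hev] with s hs using hf.deriv_le_slope hs.1 hs.2
    · filter_upwards [hev] with s hs using hf.slope_le_deriv hs.1 hs.2
  refine (hl.mul ((tendsto_slope_expInt (-2 * lam) t).mono_left (nhdsLT_le_nhdsNE t))).congr' ?_
  filter_upwards [self_mem_nhdsWithin] with r hr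
  rw [slope_comm f, slope_comm (expInt _), slope_eq_mul f lam hr]

theorem exists_countable_differentiableAt (hf : IntrinsicConvex lam f) :
    ∃ T : Set ℝ, T ⊆ Ioi 0 ∧ T.Countable ∧ ∀ t ∈ Ioi (0 : ℝ) \ T, DifferentiableAt ℝ f t := by
  refine ⟨_, fun t ht => ht.1, hf.monotoneOn_deriv.countable_not_continuousWithinAt, ?_⟩
  rintro t ⟨ht, hT⟩
  exact hf.differentiableAt ht (by by_contra hc; exact hT ⟨ht, hc⟩)

theorem deriv_nonpos (hf : IntrinsicConvex lam f) (hanti : AntitoneOn f (Ioi 0)) {t : ℝ}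
    (ht : 0 < t) : intrinsicDeriv lam f t ≤ 0 :=
  (hf.deriv_le_slope ht (lt_add_one t)).trans <| div_nonpos_of_nonpos_of_nonneg
    (sub_nonpos.2 (hanti ht (ht.trans (lt_add_one t)) (lt_add_one t).le))
    (expInt_sub_pos _ (lt_add_one t)).le

/-- The mean value theorem for `E_λ`, whose derivative is `exp (λ ·)`. -/
theorem exists_slope_expInt_eq (lam : ℝ) {s t : ℝ} (h : s < t) :
    ∃ r ∈ Ioo s t, slope (expInt lam) s t = Real.exp (lam * r) := by
  obtain ⟨r, hr, e⟩ := exists_deriv_eq_slope (expInt lam) h (continuous_expInt lam).continuousOn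
    (fun x _ => (hasDerivAt_expInt lam x).differentiableAt.differentiableWithinAt)
  exact ⟨r, hr, by rw [slope_def_field, ← e, (hasDerivAt_expInt lam r).deriv]⟩

/-- A non-increasing convex function of the concave change of variable `τ` is convex. -/
theorem convexOn (hf : IntrinsicConvex lam f) (hanti : AntitoneOn f (Ioi 0)) (hlam : 0 ≤ lam) :
    ConvexOn ℝ (Ioi 0) f := by
  refine convexOn_of_slope_mono_adjacent (convex_Ioi 0) fun {s q t} hs _ hsq hqt => ?_
  rw [← slope_def_field, ← slope_def_field, slope_eq_mul f lam hsq, slope_eq_mul f lam hqt]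
  obtain ⟨r₁, hr₁, e₁⟩ := exists_slope_expInt_eq (-2 * lam) hsq
  obtain ⟨r₂, hr₂, e₂⟩ := exists_slope_expInt_eq (-2 * lam) hqt
  rw [e₁, e₂]
  have hq : 0 < q := lt_trans hs hsq
  have h1 : Real.exp (-2 * lam * r₂) ≤ Real.exp (-2 * lam * r₁) :=
    Real.exp_le_exp.2 (mul_le_mul_of_nonpos_left (hr₁.2.trans hr₂.1).le (by linarith))
  have h2 : intrinsicSlope lam f s q ≤ 0 :=
    (hf.slope_le_deriv hs hsq).trans (hf.deriv_nonpos hanti hq)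
  calc _ ≤ intrinsicSlope lam f s q * Real.exp (-2 * lam * r₂) := mul_le_mul_of_nonpos_left h1 h2
    _ ≤ _ := mul_le_mul_of_nonneg_right (hf s q t hs hsq hqt) (Real.exp_pos _).le

/-- When `τ` fails to be concave, its second derivative is still bounded on compact intervals, and
so is the intrinsic derivative of `f`. -/
theorem locallySemiconvexOnPos (hf : IntrinsicConvex lam f) (hanti : AntitoneOn f (Ioi 0)) :
    LocallySemiconvexOnPos f := by
  intro a b ha hab
  set M : ℝ := -intrinsicDeriv lam f a with hM
  have hM0 : 0 ≤ M := by have := hf.deriv_nonpos hanti ha; linarith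
  set C : ℝ := |2 * lam| * Real.exp (|2 * lam| * b) with hC
  have hC0 : 0 ≤ C := by positivity
  refine ⟨M * C, by positivity, convexOn_of_slope_mono_adjacent (convex_Icc a b)
    fun {s q t} hs' ht' hsq hqt => ?_⟩
  have hs : 0 < s := ha.trans_le hs'.1
  have hq : 0 < q := hs.trans hsq
  obtain ⟨r₁, hr₁, e₁⟩ := exists_slope_expInt_eq (-2 * lam) hsq
  obtain ⟨r₂, hr₂, e₂⟩ := exists_slope_expInt_eq (-2 * lam) hqt
  have k1 : (f q - f s) / (q - s) = intrinsicSlope lam f s q * Real.exp (-2 * lam * r₁) := by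
    rw [← e₁, ← slope_eq_mul f lam hsq, slope_def_field]
  have k2 : (f t - f q) / (t - q) = intrinsicSlope lam f q t * Real.exp (-2 * lam * r₂) := by
    rw [← e₂, ← slope_eq_mul f lam hqt, slope_def_field]
  have l1 : (f q + M * C * q ^ 2 - (f s + M * C * s ^ 2)) / (q - s)
      = (f q - f s) / (q - s) + M * C * (q + s) := by
    have : q - s ≠ 0 := by linarith
    field_simp; ring
  have l2 : (f t + M * C * t ^ 2 - (f q + M * C * q ^ 2)) / (t - q)
      = (f t - f q) / (t - q) + M * C * (t + q) := by
    have : t - q ≠ 0 := by linarith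
    field_simp; ring
  simp only [l1, l2, k1, k2]
  have hslope := hf s q t hs hsq hqt
  have hqtM : -intrinsicSlope lam f q t ≤ M := by
    have := hf.deriv_le_slope hq hqt
    have := hf.monotoneOn_deriv ha hq (hs'.1.trans hsq.le)
    linarith
  have hr12 : 0 < r₂ - r₁ := sub_pos.2 (hr₁.2.trans hr₂.1)
  have hr₂b : r₂ ≤ b := hr₂.2.le.trans ht'.2
  have hr₂0 : 0 ≤ r₂ := hq.le.trans hr₂.1.le
  -- Growth of `exp (-2λ ·)` between the two intermediate points.
  have hgrow : Real.exp (-2 * lam * r₂) - Real.exp (-2 * lam * r₁) ≤ C * (t - s) := by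
    have h1 := Real.add_one_le_exp (-2 * lam * (r₁ - r₂))
    have h2 : Real.exp (-2 * lam * r₁)
        = Real.exp (-2 * lam * r₂) * Real.exp (-2 * lam * (r₁ - r₂)) := by
      rw [← Real.exp_add]; ring_nf
    have h3 : Real.exp (-2 * lam * r₂) ≤ Real.exp (|2 * lam| * b) := by
      refine Real.exp_le_exp.2 ?_
      calc -2 * lam * r₂ ≤ |2 * lam| * r₂ :=
            mul_le_mul_of_nonneg_right (by have := neg_abs_le (2 * lam); linarith) hr₂0
        _ ≤ _ := mul_le_mul_of_nonneg_left hr₂b (abs_nonneg _)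
    have h4 : -(2 * lam) * (r₂ - r₁) ≤ |2 * lam| * (r₂ - r₁) :=
      mul_le_mul_of_nonneg_right (neg_le_abs _) hr12.le
    have h5 : r₂ - r₁ ≤ t - s := by linarith [hr₁.1, hr₂.2]
    calc Real.exp (-2 * lam * r₂) - Real.exp (-2 * lam * r₁)
        = Real.exp (-2 * lam * r₂) * (1 - Real.exp (-2 * lam * (r₁ - r₂))) := by rw [h2]; ring
      _ ≤ Real.exp (-2 * lam * r₂) * (|2 * lam| * (r₂ - r₁)) :=
          mul_le_mul_of_nonneg_left (by linarith) (Real.exp_pos _).le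
      _ ≤ Real.exp (|2 * lam| * b) * (|2 * lam| * (r₂ - r₁)) :=
          mul_le_mul_of_nonneg_right h3 (by positivity)
      _ ≤ Real.exp (|2 * lam| * b) * (|2 * lam| * (t - s)) := by gcongr
      _ = C * (t - s) := by rw [hC]; ring
  have m1 : intrinsicSlope lam f s q * Real.exp (-2 * lam * r₁)
      ≤ intrinsicSlope lam f q t * Real.exp (-2 * lam * r₁) :=
    mul_le_mul_of_nonneg_right hslope (Real.exp_pos _).le
  have hts : 0 ≤ t - s := by linarith
  have hqt0 : intrinsicSlope lam f q t ≤ 0 :=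
    (hf.slope_le_deriv hq hqt).trans (hf.deriv_nonpos hanti (hq.trans hqt))
  have m2 : -intrinsicSlope lam f q t * (Real.exp (-2 * lam * r₂) - Real.exp (-2 * lam * r₁))
      ≤ M * (C * (t - s)) :=
    (mul_le_mul_of_nonneg_left hgrow (by linarith)).trans
      (mul_le_mul_of_nonneg_right hqtM (by positivity))
  linarith

end IntrinsicConvex

/-! ### Evolution variational inequalities with finite energies -/

variable {X : Type*} {lam : ℝ} {c : X → X → ℝ} {φ : X → EReal} {x : ℝ → X}

/-- `φ` takes values in `(-∞, +∞]` and is finite somewhere. -/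
structure IsProperEnergy (φ : X → EReal) : Prop where
  ne_bot : ∀ y, φ y ≠ ⊥
  exists_ne_top : ∃ y, φ y ≠ ⊤

theorem IsProperEnergy.coe_toReal (hφ : IsProperEnergy φ) {y : X} (hy : φ y ≠ ⊤) :
    ((φ y).toReal : EReal) = φ y :=
  EReal.coe_toReal hy (hφ.ne_bot y)

theorem IsMinimizer.ne_top {z : X} (hz : IsMinimizer φ z) (hφ : IsProperEnergy φ) : φ z ≠ ⊤ := by
  obtain ⟨y, hy⟩ := hφ.exists_ne_top
  exact ne_top_of_le_ne_top hy (hz y)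

theorem IsMinimizer.toReal_le {z y : X} (hz : IsMinimizer φ z) (hφ : IsProperEnergy φ)
    (hy : φ y ≠ ⊤) : (φ z).toReal ≤ (φ y).toReal :=
  EReal.toReal_le_toReal (hz y) (hφ.ne_bot z) hy

namespace IsEVI

/-- At positive times the inequality has a positive factor in front of `-φ (x t)`. -/
theorem energy_ne_top (hx : IsEVI lam c φ x) (hφ : IsProperEnergy φ) {t : ℝ} (ht : 0 < t) :
    φ (x t) ≠ ⊤ := by
  intro htop
  obtain ⟨y, hy⟩ := hφ.exists_ne_top
  have h := hx (t / 2) t (by linarith) (by linarith) y hy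
  rw [htop, ← hφ.coe_toReal hy, EReal.sub_top,
    EReal.coe_mul_bot_of_pos (expInt_pos lam (by linarith)), le_bot_iff] at h
  exact EReal.coe_ne_bot _ h

theorem coe_energyAlong (hx : IsEVI lam c φ x) (hφ : IsProperEnergy φ) {t : ℝ} (ht : 0 < t) :
    (energyAlong φ x t : EReal) = φ (x t) :=
  hφ.coe_toReal (hx.energy_ne_top hφ ht)

/-- The inequality between real numbers. -/
theorem le (hx : IsEVI lam c φ x) (hφ : IsProperEnergy φ) {s t : ℝ} (hs : 0 < s) (hst : s ≤ t)
    {y : X} (hy : φ y ≠ ⊤) :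
    Real.exp (lam * (t - s)) * c y (x t) - c y (x s)
      ≤ expInt lam (t - s) * ((φ y).toReal - energyAlong φ x t) := by
  have h := hx s t hs hst y hy
  rw [← hφ.coe_toReal hy, ← hx.coe_energyAlong hφ (hs.trans_le hst), ← EReal.coe_sub,
    ← EReal.coe_mul, EReal.coe_le_coe_iff] at h
  exact h

theorem cost_le (hx : IsEVI lam c φ x) (hφ : IsProperEnergy φ) (hc : IsDissipative c) {s t : ℝ}
    (hs : 0 < s) (hst : s ≤ t) :
    Real.exp (lam * (t - s)) * c (x s) (x t)
      ≤ expInt lam (t - s) * (energyAlong φ x s - energyAlong φ x t) := by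
  have h := hx.le hφ hs hst (hx.energy_ne_top hφ hs)
  rwa [(hc.eq_zero_iff _ _).2 rfl, sub_zero] at h

theorem antitoneOn_energy (hx : IsEVI lam c φ x) (hφ : IsProperEnergy φ) (hc : IsDissipative c) :
    AntitoneOn (energyAlong φ x) (Ioi 0) := by
  intro s hs t _ hst
  rcases hst.eq_or_lt with rfl | hst
  · rfl
  · have h1 := hx.cost_le hφ hc hs hst.le
    have h2 := mul_nonneg (Real.exp_pos (lam * (t - s))).le (hc.nonneg (x s) (x t))
    have h3 := nonneg_of_mul_nonneg_right (h2.trans h1) (expInt_pos lam (sub_pos.2 hst))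
    linarith

/-- The curve is right-continuous: `c (x t) (x r)` is controlled by `E_λ(r - t)`. -/
theorem tendsto_nhdsGT [TopologicalSpace X] (hx : IsEVI lam c φ x) (hφ : IsProperEnergy φ)
    (hc : IsDissipative c) (hcomp : IsCompatible c φ) {t : ℝ} (ht : 0 < t) :
    Tendsto x (𝓝[>] t) (𝓝 (x t)) := by
  refine hcomp.tendsto_of_cost (energyAlong φ x t) _ _ ?_ (Or.inr (tendsto_map'_iff.2 ?_))
  · rw [eventually_map]
    filter_upwards [self_mem_nhdsWithin] with r hr
    have hr0 : 0 < r := ht.trans hr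
    rw [← hx.coe_energyAlong hφ hr0, EReal.coe_le_coe_iff]
    exact hx.antitoneOn_energy hφ hc ht hr0 (le_of_lt hr)
  · have hlim : Tendsto (fun r => Real.exp (-(lam * (r - t))) * (expInt lam (r - t) *
        (energyAlong φ x t - energyAlong φ x (t + 1)))) (𝓝[>] t) (𝓝 0) := by
      have h1 := continuous_expInt lam
      have h2 : Continuous (fun r => Real.exp (-(lam * (r - t))) * (expInt lam (r - t) *
        (energyAlong φ x t - energyAlong φ x (t + 1)))) := by fun_prop
      have h3 := h2.tendsto t
      rw [sub_self, expInt_zero, zero_mul, mul_zero] at h3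
      exact h3.mono_left nhdsWithin_le_nhds
    refine squeeze_zero' (Eventually.of_forall fun r => hc.nonneg _ _) ?_ hlim
    filter_upwards [Ioo_mem_nhdsGT (lt_add_one t)] with r hr
    have h1 := hx.cost_le hφ hc ht hr.1.le
    have h2 := hx.antitoneOn_energy hφ hc (ht.trans hr.1) (ht.trans (lt_add_one t)) hr.2.le
    have h3 : 0 ≤ expInt lam (r - t) := expInt_nonneg _ (by linarith [hr.1])
    calc c (x t) (x r)
        = Real.exp (-(lam * (r - t))) * (Real.exp (lam * (r - t)) * c (x t) (x r)) := by
          rw [← mul_assoc, ← Real.exp_add, neg_add_cancel, Real.exp_zero, one_mul]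
      _ ≤ _ := mul_le_mul_of_nonneg_left (h1.trans (mul_le_mul_of_nonneg_left (by linarith) h3))
          (Real.exp_pos _).le

/-- `λ`-contraction. On `[s, t]`, test `x` with `x' t` and `x'` with `x s`: up to second order in
`t - s` the sum of the two inequalities has `(t - s) (f s - f t)` on the right, `f` being the energy
along `x`, and these terms telescope. -/
theorem contraction {x' : ℝ → X} (hx : IsEVI lam c φ x) (hx' : IsEVI lam c φ x')
    (hφ : IsProperEnergy φ) (hc : IsDissipative c) (hc_symm : ∀ y z, c y z = c z y) {a b : ℝ}
    (ha : 0 < a) (hab : a ≤ b) :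
    c (x b) (x' b) ≤ Real.exp (-2 * lam * (b - a)) * c (x a) (x' a) := by
  set f := energyAlong φ x with hf
  set g := energyAlong φ x' with hg
  have hfa := hx.antitoneOn_energy hφ hc
  have hga := hx'.antitoneOn_energy hφ hc
  rw [← hf] at hfa
  rw [← hg] at hga
  -- Bounds, uniform on `[a, b]`, for the exponential factors and the energies.
  set C : ℝ := Real.exp (|lam| * (b - a)) with hC
  set M : ℝ := |f a| + |f b| + |g a| + |g b| with hM
  have hba : 0 ≤ |lam| * (b - a) := mul_nonneg (abs_nonneg _) (by linarith)
  have hC1 : 1 ≤ C := Real.one_le_exp hba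
  have hM0 : 0 ≤ M := by positivity
  have key : Real.exp (2 * lam * (b - a)) * c (x b) (x' b)
      ≤ Real.exp (2 * lam * (a - a)) * c (x a) (x' a) := by
    refine le_of_forall_sub_le_mul_sub
      (u := fun t => Real.exp (2 * lam * (t - a)) * c (x t) (x' t))
      (v := fun t => C ^ 3 * f t - C ^ 4 * |lam| * M * t) hab fun s t has hst htb => ?_
    have hs : 0 < s := ha.trans_le has
    have ht : 0 < t := hs.trans_le hst
    have h1 := hx.le hφ hs hst (hx'.energy_ne_top hφ ht)
    have h2 := hx'.le hφ hs hst (hx.energy_ne_top hφ hs)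
    change _ ≤ expInt lam (t - s) * (g t - f t) at h1
    change _ ≤ expInt lam (t - s) * (f s - g t) at h2
    rw [hc_symm (x' t) (x t), hc_symm (x' t) (x s)] at h1
    have hE0 : 0 ≤ expInt lam (t - s) := expInt_nonneg _ (by linarith)
    have hE1 : expInt lam (t - s) ≤ C * (t - s) := expInt_le_exp_mul lam (by linarith) (by linarith)
    have hexp := mul_expInt lam (t - s)
    set e := Real.exp (lam * (t - s)) with he
    set E := expInt lam (t - s) with hE
    have he0 : 0 < e := Real.exp_pos _
    -- The mixed terms `c (x s) (x' t)` cancel.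
    have h3 : e * (e * c (x t) (x' t)) - c (x s) (x' s)
        ≤ E * (f s - f t) + E * (lam * E) * (g t - f t) := by
      rw [hexp]; nlinarith [mul_le_mul_of_nonneg_left h1 he0.le]
    have hbd : |g t - f t| ≤ M := by
      have hb : 0 < b := ha.trans_le hab
      have k1 := hfa ha ht (has.trans hst)
      have k2 := hfa ht hb htb
      have k3 := hga ha ht (has.trans hst)
      have k4 := hga ht hb htb
      rw [abs_le, hM]
      constructor <;> linarith [neg_abs_le (f a), le_abs_self (f a), neg_abs_le (f b),
        le_abs_self (f b), neg_abs_le (g a), le_abs_self (g a), neg_abs_le (g b), le_abs_self (g b)]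
    have hfd : 0 ≤ f s - f t := sub_nonneg.2 (hfa hs ht hst)
    have hts : 0 ≤ t - s := by linarith
    have h4 : E * (lam * E) * (g t - f t) ≤ C * (t - s) * (|lam| * (C * (t - s))) * M := by
      calc E * (lam * E) * (g t - f t) ≤ |E * (lam * E) * (g t - f t)| := le_abs_self _
        _ = E * (|lam| * E) * |g t - f t| := by rw [abs_mul, abs_mul, abs_mul, abs_of_nonneg hE0]
        _ ≤ _ := by gcongr
    have h5 : E * (f s - f t) ≤ C * (t - s) * (f s - f t) := by gcongr
    have hw : Real.exp (2 * lam * (s - a)) ≤ C ^ 2 := by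
      rw [hC, ← Real.exp_nat_mul]
      refine Real.exp_le_exp.2 ?_
      have k1 : lam * (s - a) ≤ |lam| * (s - a) :=
        mul_le_mul_of_nonneg_right (le_abs_self _) (by linarith)
      have k2 : |lam| * (s - a) ≤ |lam| * (b - a) :=
        mul_le_mul_of_nonneg_left (by linarith) (abs_nonneg _)
      push_cast; linarith
    have hsplit : Real.exp (2 * lam * (t - a)) = Real.exp (2 * lam * (s - a)) * (e * e) := by
      rw [he, ← Real.exp_add, ← Real.exp_add]; ring_nf
    have hnn : 0 ≤ C * (t - s) * (f s - f t) + C * (t - s) * (|lam| * (C * (t - s))) * M := by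
      positivity
    calc Real.exp (2 * lam * (t - a)) * c (x t) (x' t) - Real.exp (2 * lam * (s - a)) * c (x s) (x' s)
        = Real.exp (2 * lam * (s - a)) * (e * (e * c (x t) (x' t)) - c (x s) (x' s)) := by
          rw [hsplit]; ring
      _ ≤ Real.exp (2 * lam * (s - a)) *
          (C * (t - s) * (f s - f t) + C * (t - s) * (|lam| * (C * (t - s))) * M) :=
          mul_le_mul_of_nonneg_left (by linarith) (Real.exp_pos _).le
      _ ≤ C ^ 2 * (C * (t - s) * (f s - f t) + C * (t - s) * (|lam| * (C * (t - s))) * M) :=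
          mul_le_mul_of_nonneg_right hw hnn
      _ = _ := by ring
  rw [sub_self, mul_zero, Real.exp_zero, one_mul] at key
  calc c (x b) (x' b)
      = Real.exp (-2 * lam * (b - a)) * (Real.exp (2 * lam * (b - a)) * c (x b) (x' b)) := by
        rw [← mul_assoc, ← Real.exp_add]; ring_nf; simp
    _ ≤ _ := mul_le_mul_of_nonneg_left key (Real.exp_pos _).le

/-! ### The integral form of the inequality -/

/-- The inequality refined along partitions: `φ (x t)` gets replaced by the exponentially weighted
energy along the curve. -/
theorem le_integral (hx : IsEVI lam c φ x) (hφ : IsProperEnergy φ) (hc : IsDissipative c)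
    {a b : ℝ} (ha : 0 < a) (hab : a ≤ b) {y : X} (hy : φ y ≠ ⊤) :
    Real.exp (lam * (b - a)) * c y (x b) - c y (x a)
      ≤ expInt lam (b - a) * (φ y).toReal
        - ∫ q in a..b, Real.exp (lam * (q - a)) * energyAlong φ x q := by
  set f := energyAlong φ x with hf
  have hfa := hx.antitoneOn_energy hφ hc
  rw [← hf] at hfa
  rw [← integral_exp_mul_const_sub hfa ha hab]
  set k := (φ y).toReal with hk
  set C : ℝ := Real.exp (|lam| * (b - a)) with hC
  have hint : ∀ s t, a ≤ s → s ≤ t → IntervalIntegrable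
      (fun q => Real.exp (lam * (q - a)) * (k - f q)) MeasureTheory.volume s t := by
    intro s t has hst
    simp_rw [mul_sub (Real.exp _)]
    exact ((intervalIntegrable_exp s t a).mul_const k).sub
      (intervalIntegrable_exp_mul hfa (ha.trans_le has) hst a)
  have key := le_of_forall_sub_le_mul_sub
    (u := fun t => Real.exp (lam * (t - a)) * c y (x t)
      - ∫ q in a..t, Real.exp (lam * (q - a)) * (k - f q))
    (v := fun t => C * f t) hab fun s t has hst htb => by
      have hs : 0 < s := ha.trans_le has
      have ht : 0 < t := hs.trans_le hst
      have h1 := mul_le_mul_of_nonneg_left (hx.le hφ hs hst hy) (Real.exp_pos (lam * (s - a))).le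
      have h2 := intervalIntegral.integral_add_adjacent_intervals (hint a s le_rfl has)
        (hint s t has hst)
      have h3 : ∫ q in s..t, Real.exp (lam * (q - a)) * (k - f t)
          = Real.exp (lam * (s - a)) * (expInt lam (t - s) * (k - f t)) := by
        rw [← integral_exp_mul_sub, ← intervalIntegral.integral_mul_const,
          ← intervalIntegral.integral_const_mul]
        congr 1; ext q
        rw [← mul_assoc, ← Real.exp_add]; ring_nf
      have h4 : ∫ q in s..t, (Real.exp (lam * (q - a)) * (k - f t)
          - Real.exp (lam * (q - a)) * (k - f q)) ≤ ∫ _ in s..t, C * (f s - f t) := by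
        refine intervalIntegral.integral_mono_on hst
          (((intervalIntegrable_exp s t a).mul_const _).sub (hint s t has hst)) (by simp)
          fun q hq => ?_
        have hq0 : 0 < q := hs.trans_le hq.1
        have k1 : f t ≤ f q := hfa hq0 ht hq.2
        have k2 : f q ≤ f s := hfa hs hq0 hq.1
        have k3 : Real.exp (lam * (q - a)) ≤ C := by
          refine Real.exp_le_exp.2 ?_
          calc lam * (q - a) ≤ |lam| * (q - a) :=
                mul_le_mul_of_nonneg_right (le_abs_self _) (by linarith [hq.1])
            _ ≤ _ := mul_le_mul_of_nonneg_left (by linarith [hq.2]) (abs_nonneg _)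
        calc _ = Real.exp (lam * (q - a)) * (f q - f t) := by ring
          _ ≤ C * (f s - f t) := mul_le_mul k3 (by linarith) (by linarith) (Real.exp_pos _).le
      rw [intervalIntegral.integral_sub ((intervalIntegrable_exp s t a).mul_const _)
        (hint s t has hst), h3, intervalIntegral.integral_const, smul_eq_mul] at h4
      have h5 : Real.exp (lam * (s - a)) * (Real.exp (lam * (t - s)) * c y (x t) - c y (x s))
          = Real.exp (lam * (t - a)) * c y (x t) - Real.exp (lam * (s - a)) * c y (x s) := by
        rw [mul_sub, ← mul_assoc, ← Real.exp_add]; ring_nf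
      rw [h5] at h1
      rw [← h2]
      linarith
  simp only [sub_self, mul_zero, Real.exp_zero, one_mul, intervalIntegral.integral_same,
    sub_zero] at key
  linarith

/-- Testing the integral inequality with the initial point. -/
theorem exp_mul_cost_le_integral (hx : IsEVI lam c φ x) (hφ : IsProperEnergy φ)
    (hc : IsDissipative c) {s t : ℝ} (hs : 0 < s) (hst : s ≤ t) :
    Real.exp (lam * (t - s)) * c (x s) (x t) ≤ expInt lam (t - s) * energyAlong φ x s
      - ∫ q in s..t, Real.exp (lam * (q - s)) * energyAlong φ x q := by
  have h := hx.le_integral hφ hc hs hst (hx.energy_ne_top hφ hs)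
  rwa [(hc.eq_zero_iff _ _).2 rfl, sub_zero] at h

/-- Testing the integral inequality with the final point. -/
theorem integral_le_cost (hx : IsEVI lam c φ x) (hφ : IsProperEnergy φ)
    (hc : IsDissipative c) (hc_symm : ∀ y z, c y z = c z y) {s t : ℝ} (hs : 0 < s) (hst : s ≤ t) :
    (∫ q in s..t, Real.exp (lam * (q - s)) * energyAlong φ x q)
      - expInt lam (t - s) * energyAlong φ x t ≤ c (x s) (x t) := by
  have h := hx.le_integral hφ hc hs hst (hx.energy_ne_top hφ (hs.trans_le hst))
  rw [(hc.eq_zero_iff _ _).2 rfl, mul_zero, hc_symm] at h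
  change _ ≤ expInt lam (t - s) * energyAlong φ x t - _ at h
  linarith

/-- The two tests bound the same cost from both sides; eliminating it leaves an inequality about
the energy alone. -/
theorem hermite_hadamard (hx : IsEVI lam c φ x) (hφ : IsProperEnergy φ)
    (hc : IsDissipative c) (hc_symm : ∀ y z, c y z = c z y) {s t : ℝ} (hs : 0 < s) (hst : s ≤ t) :
    (1 + Real.exp (lam * (t - s))) *
        ∫ q in s..t, Real.exp (lam * (q - s)) * energyAlong φ x q
      ≤ expInt lam (t - s) *
        (Real.exp (lam * (t - s)) * energyAlong φ x t + energyAlong φ x s) := by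
  have h1 := hx.exp_mul_cost_le_integral hφ hc hs hst
  have h2 := mul_le_mul_of_nonneg_left (hx.integral_le_cost hφ hc hc_symm hs hst)
    (Real.exp_pos (lam * (t - s))).le
  linarith

/-! ### Regularity of the energy -/

/-- Right-continuity comes from lower semicontinuity of `φ`; at a downward jump from the left the
Hermite-Hadamard inequality on short intervals would fail. -/
theorem continuousOn_energy [TopologicalSpace X] (hx : IsEVI lam c φ x) (hφ : IsProperEnergy φ)
    (hc : IsDissipative c) (hc_symm : ∀ y z, c y z = c z y) (hcomp : IsCompatible c φ) :
    ContinuousOn (energyAlong φ x) (Ioi 0) := by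
  intro t ht
  have ht : 0 < t := ht
  refine ContinuousAt.continuousWithinAt (continuousAt_iff_continuous_left'_right'.2 ⟨?_, ?_⟩)
  all_goals set f := energyAlong φ x with hf
  all_goals have hfa := hx.antitoneOn_energy hφ hc
  all_goals rw [← hf] at hfa
  · have hanti : AntitoneOn f (Ioo 0 t) := hfa.mono fun r hr => hr.1
    have hbdd : BddBelow (f '' Ioo 0 t) := by
      refine ⟨f t, ?_⟩
      rintro _ ⟨r, hr, rfl⟩
      exact hfa hr.1 ht hr.2.le
    set l := sInf (f '' Ioo 0 t) with hl
    have hlim : Tendsto f (𝓝[<] t) (𝓝 l) := by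
      refine tendsto_order.2 ⟨fun a ha => ?_, fun a ha => ?_⟩
      · filter_upwards [Ioo_mem_nhdsLT ht] with r hr
        exact ha.trans_le (csInf_le hbdd ⟨r, hr, rfl⟩)
      · obtain ⟨_, ⟨r, hr, rfl⟩, hra⟩ := exists_lt_of_csInf_lt ((nonempty_Ioo.2 ht).image f) ha
        filter_upwards [Ioo_mem_nhdsLT hr.2] with q hq
        exact (hanti hr ⟨hr.1.trans hq.1, hq.2⟩ hq.1.le).trans_lt hra
    have htl : f t ≤ l := by
      refine ge_of_tendsto hlim ?_
      filter_upwards [Ioo_mem_nhdsLT ht] with r hr using hfa hr.1 ht hr.2.le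
    have hlt : l ≤ f t := by
      have hl1 : Tendsto (fun s => (1 + Real.exp (lam * (t - s))) * l) (𝓝[<] t)
          (𝓝 ((1 + Real.exp (lam * (t - t))) * l)) :=
        ((by fun_prop : Continuous fun s => (1 + Real.exp (lam * (t - s))) * l).tendsto t).mono_left
          nhdsWithin_le_nhds
      have hl2 : Tendsto (fun s => Real.exp (lam * (t - s)) * f t + f s) (𝓝[<] t)
          (𝓝 (Real.exp (lam * (t - t)) * f t + l)) :=
        (((by fun_prop : Continuous fun s => Real.exp (lam * (t - s)) * f t).tendsto t).mono_left
          nhdsWithin_le_nhds).add hlim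
      have hle := le_of_tendsto_of_tendsto hl1 hl2 (by
        filter_upwards [Ioo_mem_nhdsLT ht] with s hs
        have h1 := hx.hermite_hadamard hφ hc hc_symm hs.1 hs.2.le
        rw [← hf] at h1
        have hE := expInt_pos lam (sub_pos.2 hs.2)
        have h2 : expInt lam (t - s) * l ≤ ∫ q in s..t, Real.exp (lam * (q - s)) * f q := by
          rw [← integral_exp_mul_sub, ← intervalIntegral.integral_mul_const]
          refine intervalIntegral.integral_mono_on_of_le_Ioo hs.2.le
            ((intervalIntegrable_exp s t s).mul_const l)
            (intervalIntegrable_exp_mul hfa hs.1 hs.2.le s) fun q hq => ?_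
          exact mul_le_mul_of_nonneg_left (csInf_le hbdd ⟨q, ⟨hs.1.trans hq.1, hq.2⟩, rfl⟩)
            (Real.exp_pos _).le
        refine le_of_mul_le_mul_left ?_ hE
        have h3 := mul_le_mul_of_nonneg_left h2
          (by positivity : 0 ≤ 1 + Real.exp (lam * (t - s)))
        linarith)
      rw [sub_self, mul_zero, Real.exp_zero] at hle
      linarith
    rw [ContinuousWithinAt, le_antisymm htl hlt]
    exact hlim
  · refine tendsto_order.2 ⟨fun a ha => ?_, fun a ha => ?_⟩
    · have h1 : ∀ᶠ y in 𝓝 (x t), (a : EReal) < φ y := hcomp.lsc_energy (x t) a (by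
        change (a : EReal) < φ (x t)
        rw [← hx.coe_energyAlong hφ ht]; exact_mod_cast ha)
      filter_upwards [(hx.tendsto_nhdsGT hφ hc hcomp ht).eventually h1, self_mem_nhdsWithin]
        with r hr hr'
      rw [← hx.coe_energyAlong hφ (ht.trans hr')] at hr
      exact_mod_cast hr
    · filter_upwards [self_mem_nhdsWithin] with r hr
      exact (hfa ht (ht.trans hr) (le_of_lt hr)).trans_lt ha

theorem intrinsicConvex [TopologicalSpace X] (hx : IsEVI lam c φ x) (hφ : IsProperEnergy φ)
    (hc : IsDissipative c) (hc_symm : ∀ y z, c y z = c z y) (hcomp : IsCompatible c φ) :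
    IntrinsicConvex lam (energyAlong φ x) :=
  intrinsicConvex_of_hermite_hadamard (hx.continuousOn_energy hφ hc hc_symm hcomp)
    fun _ _ hs hst => hx.hermite_hadamard hφ hc hc_symm hs hst.le

end IsEVI

/-- The exponential average over `[s, t]` of the drop from the initial value. -/
theorem IntrinsicConvex.integral_initial_le {f : ℝ → ℝ} (hf : IntrinsicConvex lam f)
    (hanti : AntitoneOn f (Ioi 0)) {s t : ℝ} (hs : 0 < s) (hst : s ≤ t) :
    expInt lam (t - s) * f s - ∫ q in s..t, Real.exp (lam * (q - s)) * f q
      ≤ -intrinsicDeriv lam f s * (Real.exp (-2 * lam * t) * Real.exp (lam * (t - s))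
          * expInt lam (t - s) ^ 2 / 2) := by
  set m := intrinsicDeriv lam f s with hm
  set τ := expInt (-2 * lam) with hτ
  have hτc : Continuous τ := continuous_expInt _
  have hI : ∫ q in s..t, Real.exp (lam * (q - s)) * (τ q - τ s)
      = Real.exp (-2 * lam * t) * Real.exp (lam * (t - s)) * expInt lam (t - s) ^ 2 / 2 := by
    have e1 : ∀ q, Real.exp (lam * (q - s)) * (τ q - τ s)
        = Real.exp (lam * (q - s)) * (τ t - τ s) - Real.exp (lam * (q - s)) * (τ t - τ q) := by
      intro q; ring
    simp_rw [e1]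
    rw [intervalIntegral.integral_sub ((intervalIntegrable_exp s t s).mul_const _)
      ((by fun_prop : Continuous fun q => Real.exp (lam * (q - s)) *
        (τ t - τ q)).intervalIntegrable _ _), intervalIntegral.integral_mul_const,
      integral_exp_mul_sub, hτ, integral_exp_mul_expInt_sub, expInt_neg_two_mul_sub]
    ring
  rw [← integral_exp_mul_const_sub hanti hs hst, ← hI, ← intervalIntegral.integral_const_mul]
  refine intervalIntegral.integral_mono_on hst ?_
    ((by fun_prop : Continuous fun q => -m * (Real.exp (lam * (q - s)) *
      (τ q - τ s))).intervalIntegrable _ _) fun q hq => ?_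
  · simp_rw [mul_sub (Real.exp _)]
    exact ((intervalIntegrable_exp s t s).mul_const _).sub
      (intervalIntegrable_exp_mul hanti hs hst s)
  · have h1 := hf.deriv_mul_le_sub hs hq.1
    have h2 : f s - f q ≤ -m * (τ q - τ s) := by linarith
    calc _ ≤ Real.exp (lam * (q - s)) * (-m * (τ q - τ s)) :=
          mul_le_mul_of_nonneg_left h2 (Real.exp_pos _).le
      _ = _ := by ring

/-- The exponential average over `[s, t]` of the excess over the final value. -/
theorem IntrinsicConvex.le_integral_final {f : ℝ → ℝ} (hf : IntrinsicConvex lam f)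
    (hanti : AntitoneOn f (Ioi 0)) {s t : ℝ} (hs : 0 < s) (hst : s ≤ t) :
    -intrinsicDeriv lam f t * (Real.exp (-2 * lam * t) * expInt lam (t - s) ^ 2 / 2)
      ≤ (∫ q in s..t, Real.exp (lam * (q - s)) * f q) - expInt lam (t - s) * f t := by
  set m := intrinsicDeriv lam f t with hm
  set τ := expInt (-2 * lam) with hτ
  have hτc : Continuous τ := continuous_expInt _
  rw [← neg_sub (expInt lam (t - s) * f t), ← integral_exp_mul_const_sub hanti hs hst, neg_mul,
    neg_le_neg_iff, ← integral_exp_mul_expInt_sub, ← hτ, ← intervalIntegral.integral_const_mul]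
  refine intervalIntegral.integral_mono_on hst ?_
    ((by fun_prop : Continuous fun q => m * (Real.exp (lam * (q - s)) *
      (τ t - τ q))).intervalIntegrable _ _) fun q hq => ?_
  · simp_rw [mul_sub (Real.exp _)]
    exact ((intervalIntegrable_exp s t s).mul_const _).sub
      (intervalIntegrable_exp_mul hanti hs hst s)
  · have h1 := hf.sub_le_deriv_mul (hs.trans_le hq.1) hq.2
    calc _ ≤ Real.exp (lam * (q - s)) * (m * (τ t - τ q)) :=
          mul_le_mul_of_nonneg_left h1 (Real.exp_pos _).le
      _ = _ := by ring

theorem tendsto_add_nhdsGT (t : ℝ) : Tendsto (fun h : ℝ => t + h) (𝓝[>] 0) (𝓝[>] t) := by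
  refine tendsto_nhdsWithin_iff.2 ⟨?_, ?_⟩
  · have := (by fun_prop : Continuous fun h : ℝ => t + h).tendsto 0
    rw [add_zero] at this
    exact this.mono_left nhdsWithin_le_nhds
  · filter_upwards [self_mem_nhdsWithin] with h hh
    have : (0 : ℝ) < h := hh
    simpa using this

theorem HasCostDerivSq.costDerivSq_eq {t v : ℝ} (h : HasCostDerivSq c x t v) :
    costDerivSq c x t = v :=
  h.limUnder_eq

namespace IsEVI

variable [TopologicalSpace X]

/-! ### The cost derivative and the energy identity -/

/-- The integral inequality bounds the cost from above by the average drop of the energy from its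
initial value, and from below by its average excess over the final value; to second order both are
half of the squared step times minus the right derivative of the energy. -/
theorem hasCostDerivSq (hx : IsEVI lam c φ x) (hφ : IsProperEnergy φ)
    (hc : IsDissipative c) (hc_symm : ∀ y z, c y z = c z y) (hcomp : IsCompatible c φ) {t : ℝ}
    (ht : 0 < t) : HasCostDerivSq c x t
      (-(intrinsicDeriv lam (energyAlong φ x) t * Real.exp (-2 * lam * t))) := by
  have hf := hx.intrinsicConvex hφ hc hc_symm hcomp
  have hanti := hx.antitoneOn_energy hφ hc
  set f := energyAlong φ x with hfdef
  set m := intrinsicDeriv lam f t with hm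
  set a := -(m * Real.exp (-2 * lam * t)) with ha
  have hdq : Tendsto (fun h => (f t - f (t + h)) / h) (𝓝[>] 0) (𝓝 a) := by
    have h1 := ((hasDerivWithinAt_iff_tendsto_slope' (by simp)).1 (hf.hasDerivWithinAt ht)).comp
      (tendsto_add_nhdsGT t)
    refine h1.neg.congr fun h => ?_
    simp only [Function.comp_apply, slope_def_field, add_sub_cancel_left]
    ring
  have hE := tendsto_expInt_div lam
  have hexp : ∀ k : ℝ, Tendsto (fun h : ℝ => Real.exp (k * h)) (𝓝[>] 0) (𝓝 1) := by
    intro k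
    have := (by fun_prop : Continuous fun h : ℝ => Real.exp (k * h)).tendsto 0
    rw [mul_zero, Real.exp_zero] at this
    exact this.mono_left nhdsWithin_le_nhds
  have hup : Tendsto (fun h => a * Real.exp (-2 * lam * h) * (expInt lam h / h) ^ 2) (𝓝[>] 0)
      (𝓝 a) := by
    simpa using ((tendsto_const_nhds (x := a)).mul (hexp (-2 * lam))).mul (hE.pow 2)
  have hlow : Tendsto (fun h => 2 * (expInt lam h / h * ((f t - f (t + h)) / h))
      - a * Real.exp (-lam * h) * (expInt lam h / h) ^ 2) (𝓝[>] 0) (𝓝 a) := by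
    have := ((hE.mul hdq).const_mul 2).sub
      (((tendsto_const_nhds (x := a)).mul (hexp (-lam))).mul (hE.pow 2))
    convert this using 2
    ring
  refine tendsto_of_tendsto_of_tendsto_of_le_of_le' hlow hup ?_ ?_
  all_goals
    filter_upwards [self_mem_nhdsWithin] with h hh
    have hh : 0 < h := hh
    have h1 := hf.integral_initial_le hanti ht (by linarith : t ≤ t + h)
    rw [add_sub_cancel_left, ← hm] at h1
    have e1 : Real.exp (-2 * lam * (t + h)) * Real.exp (lam * h)
        = Real.exp (-2 * lam * t) * Real.exp (-lam * h) := by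
      rw [← Real.exp_add, ← Real.exp_add]; ring_nf
    rw [e1] at h1
  · have h2 := hx.integral_le_cost hφ hc hc_symm ht (by linarith : t ≤ t + h)
    rw [add_sub_cancel_left, ← hfdef] at h2
    have e2 : 2 * (expInt lam h / h * ((f t - f (t + h)) / h))
        - a * Real.exp (-lam * h) * (expInt lam h / h) ^ 2
        = (2 * (expInt lam h * (f t - f (t + h)))
          - a * Real.exp (-lam * h) * expInt lam h ^ 2) / h ^ 2 := by
      field_simp
    rw [e2]
    refine div_le_div_of_nonneg_right ?_ (by positivity)
    rw [ha]
    linarith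
  · have h2 := hx.exp_mul_cost_le_integral hφ hc ht (by linarith : t ≤ t + h)
    rw [add_sub_cancel_left, ← hfdef] at h2
    have e2 : a * Real.exp (-2 * lam * h) * (expInt lam h / h) ^ 2
        = (a * Real.exp (-2 * lam * h) * expInt lam h ^ 2) / h ^ 2 := by
      field_simp
    rw [e2]
    refine div_le_div_of_nonneg_right ?_ (by positivity)
    have h3 := mul_le_mul_of_nonneg_left (h2.trans h1) (Real.exp_pos (-lam * h)).le
    have e3 : Real.exp (-lam * h) * (Real.exp (lam * h) * c (x t) (x (t + h)))
        = c (x t) (x (t + h)) := by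
      rw [← mul_assoc, ← Real.exp_add]; simp
    have e4 : Real.exp (-2 * lam * h) = Real.exp (-lam * h) * Real.exp (-lam * h) := by
      rw [← Real.exp_add]; ring_nf
    rw [e3] at h3
    rw [ha, e4]
    linarith

theorem costDerivSq_eq (hx : IsEVI lam c φ x) (hφ : IsProperEnergy φ)
    (hc : IsDissipative c) (hc_symm : ∀ y z, c y z = c z y) (hcomp : IsCompatible c φ) {t : ℝ}
    (ht : 0 < t) : costDerivSq c x t
      = -(intrinsicDeriv lam (energyAlong φ x) t * Real.exp (-2 * lam * t)) :=
  (hx.hasCostDerivSq hφ hc hc_symm hcomp ht).costDerivSq_eq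

theorem costDerivSq_nonneg (hx : IsEVI lam c φ x) (hφ : IsProperEnergy φ)
    (hc : IsDissipative c) (hc_symm : ∀ y z, c y z = c z y) (hcomp : IsCompatible c φ) {t : ℝ}
    (ht : 0 < t) : 0 ≤ costDerivSq c x t := by
  rw [hx.costDerivSq_eq hφ hc hc_symm hcomp ht, neg_nonneg]
  exact mul_nonpos_of_nonpos_of_nonneg ((hx.intrinsicConvex hφ hc hc_symm hcomp).deriv_nonpos
    (hx.antitoneOn_energy hφ hc) ht) (Real.exp_pos _).le

theorem exp_mul_costDerivSq (hx : IsEVI lam c φ x) (hφ : IsProperEnergy φ)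
    (hc : IsDissipative c) (hc_symm : ∀ y z, c y z = c z y) (hcomp : IsCompatible c φ) {t : ℝ}
    (ht : 0 < t) : Real.exp (2 * lam * t) * costDerivSq c x t
      = -intrinsicDeriv lam (energyAlong φ x) t := by
  rw [hx.costDerivSq_eq hφ hc hc_symm hcomp ht, mul_neg, mul_left_comm, ← Real.exp_add]
  simp

theorem antitoneOn_exp_mul_costDerivSq (hx : IsEVI lam c φ x) (hφ : IsProperEnergy φ)
    (hc : IsDissipative c) (hc_symm : ∀ y z, c y z = c z y) (hcomp : IsCompatible c φ) :
    AntitoneOn (fun t => Real.exp (2 * lam * t) * costDerivSq c x t) (Ioi 0) := by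
  intro s hs t ht hst
  simp only [hx.exp_mul_costDerivSq hφ hc hc_symm hcomp hs,
    hx.exp_mul_costDerivSq hφ hc hc_symm hcomp ht, neg_le_neg_iff]
  exact (hx.intrinsicConvex hφ hc hc_symm hcomp).monotoneOn_deriv hs ht hst

/-- If the cost derivative vanishes at `t`, the energy is constant from `t` on and the slope is `0`.
Otherwise the quotient in the slope is the one of the energy over the square root of the one of the
cost, whose limits are `|ẋ|²` and `|ẋ|`. -/
theorem costDeriv_eq_slopeAlong (hx : IsEVI lam c φ x) (hφ : IsProperEnergy φ)
    (hc : IsDissipative c) (hc_symm : ∀ y z, c y z = c z y) (hcomp : IsCompatible c φ) {t : ℝ}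
    (ht : 0 < t) : ((costDeriv c x t : ℝ) : EReal) = slopeAlong c φ x t := by
  have hf := hx.intrinsicConvex hφ hc hc_symm hcomp
  have hanti := hx.antitoneOn_energy hφ hc
  have hcd := hx.hasCostDerivSq hφ hc hc_symm hcomp ht
  have ha0 := hx.costDerivSq_nonneg hφ hc hc_symm hcomp ht
  have ha := hx.costDerivSq_eq hφ hc hc_symm hcomp ht
  rw [← ha] at hcd
  set f := energyAlong φ x with hfdef
  have hder := hf.hasDerivWithinAt ht
  rw [← neg_eq_iff_eq_neg.2 ha] at hder
  set a := costDerivSq c x t with hadef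
  have heq : ∀ᶠ h in 𝓝[>] (0 : ℝ), (((f t - f (t + h)) / √(2 * c (x t) (x (t + h))) : ℝ) : EReal)
      = max (φ (x t) - φ (x (t + h))) 0 / ((√(2 * c (x t) (x (t + h))) : ℝ) : EReal) := by
    filter_upwards [self_mem_nhdsWithin] with h hh
    have hh : 0 < h := hh
    have hle : f (t + h) ≤ f t := hanti ht (by simp; linarith : t + h ∈ Ioi 0) (by linarith)
    rw [← hx.coe_energyAlong hφ ht, ← hx.coe_energyAlong hφ (by linarith : 0 < t + h), ← hfdef,
      ← EReal.coe_sub, max_eq_left (by exact_mod_cast sub_nonneg.2 hle), ← EReal.coe_div]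
  have hlim : Tendsto (fun h => (f t - f (t + h)) / √(2 * c (x t) (x (t + h)))) (𝓝[>] 0)
      (𝓝 √a) := by
    rcases ha0.eq_or_lt with h0 | hpos
    · rw [← h0, Real.sqrt_zero]
      refine tendsto_const_nhds.congr' ?_
      filter_upwards [self_mem_nhdsWithin] with h hh
      have hh : 0 < h := hh
      have h1 := hf.deriv_mul_le_sub ht (by linarith : t ≤ t + h)
      have hm : intrinsicDeriv lam f t = 0 := by
        have h2 := hx.exp_mul_costDerivSq hφ hc hc_symm hcomp ht
        rw [← hadef, ← h0, mul_zero, ← hfdef] at h2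
        linarith
      have hle : f (t + h) ≤ f t := hanti ht (by simp; linarith : t + h ∈ Ioi 0) (by linarith)
      rw [hm, zero_mul] at h1
      rw [show f t - f (t + h) = 0 by linarith, zero_div]
    · have hsq : √a ≠ 0 := (Real.sqrt_pos.2 hpos).ne'
      have h1 : Tendsto (fun h => (f t - f (t + h)) / h) (𝓝[>] 0) (𝓝 a) := by
        have h1 := ((hasDerivWithinAt_iff_tendsto_slope' (by simp)).1 hder).comp
          (tendsto_add_nhdsGT t)
        rw [← neg_neg a]
        refine h1.neg.congr fun h => ?_
        simp only [Function.comp_apply, slope_def_field, add_sub_cancel_left]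
        ring
      have h2 := h1.div ((Real.continuous_sqrt.tendsto a).comp hcd) hsq
      have e : a / √a = √a := Real.div_sqrt
      rw [e] at h2
      refine h2.congr' ?_
      filter_upwards [self_mem_nhdsWithin] with h hh
      have hh : 0 < h := hh
      simp only [Pi.div_apply, Function.comp_apply]
      rw [Real.sqrt_div (mul_nonneg two_pos.le (hc.nonneg _ _)), Real.sqrt_sq hh.le]
      field_simp
  have hlimE : Tendsto (fun h =>
      (((f t - f (t + h)) / √(2 * c (x t) (x (t + h))) : ℝ) : EReal)) (𝓝[>] 0)
      (𝓝 ((√a : ℝ) : EReal)) := (continuous_coe_real_ereal.tendsto _).comp hlim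
  exact ((hlimE.congr' heq).limsup_eq).symm

theorem a_priori_estimate (hx : IsEVI lam c φ x) (hφ : IsProperEnergy φ)
    (hc : IsDissipative c) (hc_symm : ∀ y z, c y z = c z y) (hcomp : IsCompatible c φ) {y : X}
    (hy : φ y ≠ ⊤) {s t : ℝ} (hs : 0 < s) (hst : s ≤ t) :
    Real.exp (lam * (t - s)) * c y (x t) - c y (x s)
        + expInt lam (t - s) ^ 2 / 2 * costDerivSq c x t
      ≤ expInt lam (t - s) * ((φ y).toReal - energyAlong φ x t) := by
  have h1 := hx.le_integral hφ hc hs hst hy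
  have h2 := (hx.intrinsicConvex hφ hc hc_symm hcomp).le_integral_final
    (hx.antitoneOn_energy hφ hc) hs hst
  rw [hx.costDerivSq_eq hφ hc hc_symm hcomp (hs.trans_le hst)]
  linarith

end IsEVI

/-! ### Asymptotic behaviour -/

theorem le_expInt {lam : ℝ} (hlam : 0 ≤ lam) (t : ℝ) : t ≤ expInt lam t := by
  rcases hlam.eq_or_lt with rfl | hlam
  · rw [expInt_zero_left]
  · rw [expInt_eq_div hlam.ne', le_div_iff₀ hlam]
    linarith [Real.add_one_le_exp (lam * t)]

theorem tendsto_expInt_atTop {lam : ℝ} (hlam : 0 ≤ lam) : Tendsto (expInt lam) atTop atTop :=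
  tendsto_atTop_mono (le_expInt hlam) tendsto_id

namespace IsEVI

theorem energy_le (hx : IsEVI lam c φ x) (hφ : IsProperEnergy φ) (hc : IsDissipative c) {y : X}
    (hy : φ y ≠ ⊤) {s t : ℝ} (hs : 0 < s) (hst : s < t) :
    energyAlong φ x t - (φ y).toReal ≤ c y (x s) / expInt lam (t - s) := by
  rw [le_div_iff₀ (expInt_pos lam (by linarith))]
  have h1 := hx.le hφ hs hst.le hy
  have h2 := mul_nonneg (Real.exp_pos (lam * (t - s))).le (hc.nonneg y (x t))
  linarith

theorem eventually_energy_lt (hx : IsEVI lam c φ x) (hφ : IsProperEnergy φ) (hc : IsDissipative c)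
    (hlam : 0 ≤ lam) {y : X} (hy : φ y ≠ ⊤) {r : ℝ} (hr : (φ y).toReal < r) :
    ∀ᶠ t in atTop, energyAlong φ x t < r := by
  have h1 : Tendsto (fun t => c y (x 1) / expInt lam (t - 1)) atTop (𝓝 0) :=
    ((tendsto_expInt_atTop hlam).comp
      (tendsto_atTop_add_const_right _ (-1) tendsto_id)).const_div_atTop _
  filter_upwards [h1.eventually (gt_mem_nhds (sub_pos.2 hr)), eventually_gt_atTop 1] with t h2 ht
  have h3 := hx.energy_le hφ hc hy one_pos ht
  linarith

theorem tendsto_energy (hx : IsEVI lam c φ x) (hφ : IsProperEnergy φ) (hc : IsDissipative c)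
    (hlam : 0 ≤ lam) {z : X} (hz : IsMinimizer φ z) :
    Tendsto (energyAlong φ x) atTop (𝓝 (φ z).toReal) := by
  refine tendsto_order.2 ⟨fun a ha => ?_, fun a ha =>
    hx.eventually_energy_lt hφ hc hlam (hz.ne_top hφ) ha⟩
  filter_upwards [eventually_gt_atTop 0] with t ht
  exact ha.trans_le (hz.toReal_le hφ (hx.energy_ne_top hφ ht))

/-- For `λ ≥ 0` the energy eventually drops below every value of `φ`; by lower semicontinuity the
cluster points of the trajectory minimize `φ`. -/
theorem isMinimizer_of_mapClusterPt [TopologicalSpace X] (hx : IsEVI lam c φ x)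
    (hφ : IsProperEnergy φ) (hc : IsDissipative c) (hcomp : IsCompatible c φ) (hlam : 0 ≤ lam)
    {z : X} (hz : MapClusterPt z atTop x) : IsMinimizer φ z := by
  intro y
  by_contra! hlt
  have hy : φ y ≠ ⊤ := ne_top_of_lt hlt
  obtain ⟨r, hr1, hr2⟩ := EReal.lt_iff_exists_real_btwn.1 hlt
  rw [← hφ.coe_toReal hy, EReal.coe_lt_coe_iff] at hr1
  have h1 : ∃ᶠ t in atTop, (r : EReal) < φ (x t) := hz.frequently (hcomp.lsc_energy z r hr2)
  obtain ⟨t, h2, h3, ht⟩ := (h1.and_eventually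
    ((hx.eventually_energy_lt hφ hc hlam hy hr1).and (eventually_gt_atTop 0))).exists
  rw [← hx.coe_energyAlong hφ ht, EReal.coe_lt_coe_iff] at h2
  linarith

theorem energy_le_initial (hx : IsEVI lam c φ x) (hφ : IsProperEnergy φ)
    (hc : IsDissipative c) {s : ℝ} (hs : 0 < s) :
    ∀ t, s ≤ t → φ (x t) ≤ (energyAlong φ x s : EReal) := by
  intro t ht
  rw [← hx.coe_energyAlong hφ (hs.trans_le ht), EReal.coe_le_coe_iff]
  exact hx.antitoneOn_energy hφ hc hs (hs.trans_le ht) ht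

theorem tendsto_of_tendsto_cost [TopologicalSpace X] (hx : IsEVI lam c φ x)
    (hφ : IsProperEnergy φ) (hc : IsDissipative c) (hcomp : IsCompatible c φ) {z : X}
    (h : Tendsto (fun t => c z (x t)) atTop (𝓝 0)) : Tendsto x atTop (𝓝 z) :=
  hcomp.tendsto_of_cost (energyAlong φ x 1) _ _
    (eventually_map.2 ((eventually_ge_atTop 1).mono (hx.energy_le_initial hφ hc one_pos)))
    (Or.inr (tendsto_map'_iff.2 h))

theorem exists_mapClusterPt_of_compactSublevels [TopologicalSpace X] (hx : IsEVI lam c φ x)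
    (hφ : IsProperEnergy φ) (hc : IsDissipative c) (hcpt : CompactSublevels φ) :
    ∃ z, MapClusterPt z atTop x := by
  obtain ⟨z, -, hz⟩ := (hcpt (energyAlong φ x 1)).exists_mapClusterPt_of_frequently
    ((eventually_ge_atTop 1).mono (hx.energy_le_initial hφ hc one_pos)).frequently
  exact ⟨z, hz⟩

/-- For `λ ≥ 0` the cost between two points of the trajectory is controlled by the energy gap. -/
theorem mul_cost_le_energy_sub (hx : IsEVI lam c φ x) (hφ : IsProperEnergy φ)
    (hc : IsDissipative c) {s t : ℝ} (hs : 0 < s) (hst : s ≤ t) (hlam : 0 ≤ lam) :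
    lam * c (x s) (x t) ≤ energyAlong φ x s - energyAlong φ x t := by
  have h1 := mul_le_mul_of_nonneg_left (hx.cost_le hφ hc hs hst) hlam
  have h2 := mul_expInt lam (t - s)
  have h3 := hx.antitoneOn_energy hφ hc hs (hs.trans_le hst) hst
  refine le_of_mul_le_mul_left (a := Real.exp (lam * (t - s))) ?_ (Real.exp_pos _)
  calc _ = lam * (Real.exp (lam * (t - s)) * c (x s) (x t)) := by ring
    _ ≤ (lam * expInt lam (t - s)) * (energyAlong φ x s - energyAlong φ x t) := by linarith
    _ ≤ _ := by rw [h2]; exact mul_le_mul_of_nonneg_right (by linarith) (by linarith)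

theorem exists_mapClusterPt_of_isCauchyCompatible [TopologicalSpace X] (hx : IsEVI lam c φ x)
    (hφ : IsProperEnergy φ) (hc : IsDissipative c) (hc_symm : ∀ y z, c y z = c z y)
    (hlam : 0 < lam) (hbdd : ∃ m : ℝ, ∀ y, (m : EReal) ≤ φ y) (hcau : IsCauchyCompatible c φ) :
    ∃ z, MapClusterPt z atTop x := by
  obtain ⟨m, hm⟩ := hbdd
  set u : ℕ → ℝ := fun n => (n : ℝ) + 1 with hu
  have hu0 : ∀ n, 0 < u n := fun n => by positivity
  have humono : Monotone u := fun i j hij => by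
    simpa [hu] using hij
  set f := energyAlong φ x with hf
  have hanti : Antitone fun n => f (u n) := fun i j hij =>
    hx.antitoneOn_energy hφ hc (hu0 i) (hu0 j) (humono hij)
  have hlim : Tendsto (fun n => f (u n)) atTop (𝓝 (⨅ n, f (u n))) := by
    refine tendsto_atTop_ciInf hanti ⟨m, ?_⟩
    rintro _ ⟨n, rfl⟩
    have := hm (x (u n))
    rwa [← hx.coe_energyAlong hφ (hu0 n), EReal.coe_le_coe_iff] at this
  obtain ⟨z, hz⟩ := hcau.cauchy (f 1) (fun n => x (u n))
    (fun n => hx.energy_le_initial hφ hc one_pos _ (by simp [hu])) (by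
      intro ε hε
      obtain ⟨N, hN⟩ := Metric.cauchySeq_iff'.1 hlim.cauchySeq (lam * ε / 2) (by positivity)
      refine ⟨N, fun i j hi hij => ?_⟩
      have h1 := hx.mul_cost_le_energy_sub hφ hc (hu0 i) (humono hij) hlam.le
      have h2 := abs_lt.1 (hN i hi.le)
      have h3 := abs_lt.1 (hN j (hi.le.trans hij))
      rw [hc_symm]
      refine lt_of_mul_lt_mul_left ?_ hlam.le
      rw [← hf] at h1
      linarith [h2.2, h3.1])
  exact ⟨z, hz.mapClusterPt.of_comp
    (tendsto_atTop_add_const_right _ 1 tendsto_natCast_atTop_atTop)⟩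

theorem exp_mul_cost_minimizer_le (hx : IsEVI lam c φ x) (hφ : IsProperEnergy φ) {z : X}
    (hz : IsMinimizer φ z) {s t : ℝ} (hs : 0 < s) (hst : s ≤ t) :
    Real.exp (lam * (t - s)) * c z (x t) ≤ c z (x s) := by
  have h1 := hx.le hφ hs hst (hz.ne_top hφ)
  have h2 : (φ z).toReal ≤ energyAlong φ x t :=
    hz.toReal_le hφ (hx.energy_ne_top hφ (hs.trans_le hst))
  have h3 := mul_nonpos_of_nonneg_of_nonpos (expInt_nonneg lam (sub_nonneg.2 hst))
    (sub_nonpos.2 h2)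
  linarith

theorem tendsto_minimizer [TopologicalSpace X] (hx : IsEVI lam c φ x) (hφ : IsProperEnergy φ)
    (hc : IsDissipative c) (hcomp : IsCompatible c φ) (hlam : 0 < lam) {z : X}
    (hz : IsMinimizer φ z) : Tendsto x atTop (𝓝 z) := by
  refine hx.tendsto_of_tendsto_cost hφ hc hcomp ?_
  have h1 : Tendsto (fun t => c z (x 1) / Real.exp (lam * (t - 1))) atTop (𝓝 0) :=
    (Real.tendsto_exp_atTop.comp ((tendsto_atTop_add_const_right _ (-1)
      tendsto_id).const_mul_atTop hlam)).const_div_atTop _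
  refine squeeze_zero' (Eventually.of_forall fun t => hc.nonneg _ _) ?_ h1
  filter_upwards [eventually_ge_atTop 1] with t ht
  rw [le_div_iff₀ (Real.exp_pos _), mul_comm]
  exact hx.exp_mul_cost_minimizer_le hφ hz one_pos ht

/-- Let `t → ∞` in the bound for the cost between two points of the trajectory. -/
theorem mul_cost_minimizer_le [TopologicalSpace X] (hx : IsEVI lam c φ x) (hφ : IsProperEnergy φ)
    (hc : IsDissipative c) (hc_symm : ∀ y z, c y z = c z y) (hcomp : IsCompatible c φ)
    (hlam : 0 < lam) {z : X} (hz : IsMinimizer φ z) {s : ℝ} (hs : 0 < s) :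
    lam * c z (x s) ≤ energyAlong φ x s - (φ z).toReal := by
  rw [← le_div_iff₀' hlam]
  refine le_of_forall_lt fun a ha => ?_
  obtain ⟨b, hab, hb⟩ := exists_between ha
  have hpair : Tendsto (fun t => (x t, x s)) atTop (𝓝 (z, x s)) :=
    (hx.tendsto_minimizer hφ hc hcomp hlam hz).prodMk_nhds tendsto_const_nhds
  refine hab.trans_le ?_
  rw [le_div_iff₀' hlam]
  have hev := hpair.eventually (hcomp.lsc_cost (z, x s) b hb)
  refine ge_of_tendsto ((hx.tendsto_energy hφ hc hlam.le hz).const_sub _) ?_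
  filter_upwards [hev, eventually_ge_atTop s] with t h1 h2
  have h3 := hx.mul_cost_le_energy_sub hφ hc hs h2 hlam.le
  rw [hc_symm] at h3
  exact (mul_le_mul_of_nonneg_left (le_of_lt h1) hlam.le).trans h3

/-- The energy gap in the inequality with `y = z` doubles the rate of the exponential decay. -/
theorem cost_minimizer_le_exp [TopologicalSpace X] (hx : IsEVI lam c φ x) (hφ : IsProperEnergy φ)
    (hc : IsDissipative c) (hc_symm : ∀ y z, c y z = c z y) (hcomp : IsCompatible c φ)
    (hlam : 0 < lam) {z : X} (hz : IsMinimizer φ z) {a b : ℝ} (ha : 0 < a) (hab : a ≤ b) :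
    c z (x b) ≤ c z (x a) * Real.exp (-2 * lam * (b - a)) := by
  set C : ℝ := Real.exp (|lam| * (b - a)) with hC
  set D : ℝ := Real.exp (2 * lam * (b - a)) * lam ^ 2 * C ^ 2 * c z (x a) with hD
  have key := le_of_forall_sub_le_mul_sub
    (u := fun t => Real.exp (2 * lam * (t - a)) * c z (x t)) (v := fun t => -(D * t)) hab
    fun s t has hst htb => by
      have hs : 0 < s := ha.trans_le has
      have ht : 0 < t := hs.trans_le hst
      have h1 := hx.le hφ hs hst (hz.ne_top hφ)
      have h2 := hx.mul_cost_minimizer_le hφ hc hc_symm hcomp hlam hz ht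
      have hct : c z (x t) ≤ c z (x a) := by
        have k := hx.exp_mul_cost_minimizer_le hφ hz ha (has.trans hst)
        have k2 : 1 ≤ Real.exp (lam * (t - a)) :=
          Real.one_le_exp (mul_nonneg hlam.le (by linarith))
        nlinarith [hc.nonneg z (x t)]
      have hct0 := hc.nonneg z (x t)
      have hE0 : 0 ≤ expInt lam (t - s) := expInt_nonneg _ (by linarith)
      have hE1 : expInt lam (t - s) ≤ C * (t - s) :=
        expInt_le_exp_mul lam (by linarith) (by linarith)
      have hexp := mul_expInt lam (t - s)
      set e := Real.exp (lam * (t - s)) with he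
      set E := expInt lam (t - s) with hE
      have h3 : e * c z (x t) - c z (x s) ≤ -(e - 1) * c z (x t) := by
        have := mul_le_mul_of_nonneg_left h2 hE0
        rw [← hexp]; linarith
      have hsplit : Real.exp (2 * lam * (t - a)) = Real.exp (2 * lam * (s - a)) * (e * e) := by
        rw [he, ← Real.exp_add, ← Real.exp_add]; ring_nf
      have hw : Real.exp (2 * lam * (s - a)) ≤ Real.exp (2 * lam * (b - a)) :=
        Real.exp_le_exp.2 (mul_le_mul_of_nonneg_left (by linarith) (by linarith))
      -- `e² - (2e - 1) = (e - 1)²` is of second order in the step.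
      calc Real.exp (2 * lam * (t - a)) * c z (x t) - Real.exp (2 * lam * (s - a)) * c z (x s)
          = Real.exp (2 * lam * (s - a)) * (e * e * c z (x t) - c z (x s)) := by
            rw [hsplit]; ring
        _ ≤ Real.exp (2 * lam * (s - a)) * ((lam * E) ^ 2 * c z (x t)) := by
            refine mul_le_mul_of_nonneg_left ?_ (Real.exp_pos _).le
            rw [hexp]; linarith
        _ ≤ Real.exp (2 * lam * (b - a)) * ((lam * (C * (t - s))) ^ 2 * c z (x a)) := by
            gcongr
        _ = _ := by rw [hD]; ring
  rw [sub_self, mul_zero, Real.exp_zero, one_mul] at key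
  calc c z (x b) = Real.exp (2 * lam * (b - a)) * c z (x b) * Real.exp (-2 * lam * (b - a)) := by
        rw [mul_right_comm, ← Real.exp_add]; ring_nf; simp
    _ ≤ _ := mul_le_mul_of_nonneg_right key (Real.exp_pos _).le

section

variable [TopologicalSpace X]

/-- The dissipation after time `t` is at most `|ẋ|²(t) ∫ exp (-2λr) dr`. -/
theorem two_mul_energy_sub_le (hx : IsEVI lam c φ x) (hφ : IsProperEnergy φ)
    (hc : IsDissipative c) (hc_symm : ∀ y z, c y z = c z y) (hcomp : IsCompatible c φ)
    (hlam : 0 ≤ lam) {z : X} (hz : IsMinimizer φ z) {t : ℝ} (ht : 0 < t) :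
    2 * lam * (energyAlong φ x t - (φ z).toReal) ≤ costDerivSq c x t := by
  have ha := hx.costDerivSq_nonneg hφ hc hc_symm hcomp ht
  refine le_of_tendsto (((hx.tendsto_energy hφ hc hlam hz).const_sub _).const_mul _) ?_
  filter_upwards [eventually_ge_atTop t] with r hr
  have h1 := (hx.intrinsicConvex hφ hc hc_symm hcomp).deriv_mul_le_sub ht hr
  have h2 := hx.exp_mul_costDerivSq hφ hc hc_symm hcomp ht
  have h3 := mul_expInt (-2 * lam) r
  have h4 := mul_expInt (-2 * lam) t
  have e1 : Real.exp (2 * lam * t) * Real.exp (-2 * lam * t) = 1 := by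
    rw [← Real.exp_add]; simp
  have h5 := mul_le_mul_of_nonneg_left h1 (by linarith : 0 ≤ 2 * lam)
  have h6 : 0 ≤ Real.exp (2 * lam * t) * costDerivSq c x t * Real.exp (-2 * lam * r) := by
    positivity
  have h7 : 2 * lam * (expInt (-2 * lam) r - expInt (-2 * lam) t)
      = Real.exp (-2 * lam * t) - Real.exp (-2 * lam * r) := by linarith
  have h8 : 2 * lam * (intrinsicDeriv lam (energyAlong φ x) t *
      (expInt (-2 * lam) r - expInt (-2 * lam) t))
      = -(Real.exp (2 * lam * t) * costDerivSq c x t)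
        * (Real.exp (-2 * lam * t) - Real.exp (-2 * lam * r)) := by
    rw [h2, ← h7]; ring
  have h9 : -(Real.exp (2 * lam * t) * costDerivSq c x t)
        * (Real.exp (-2 * lam * t) - Real.exp (-2 * lam * r))
      = -costDerivSq c x t
        + Real.exp (2 * lam * t) * costDerivSq c x t * Real.exp (-2 * lam * r) := by
    linear_combination (-costDerivSq c x t) * e1
  linarith

theorem costDeriv_le_mul_exp (hx : IsEVI lam c φ x) (hφ : IsProperEnergy φ)
    (hc : IsDissipative c) (hc_symm : ∀ y z, c y z = c z y) (hcomp : IsCompatible c φ) {s t : ℝ}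
    (hs : 0 < s) (hst : s ≤ t) :
    costDeriv c x t ≤ costDeriv c x s * Real.exp (-lam * (t - s)) := by
  have h1 := hx.antitoneOn_exp_mul_costDerivSq hφ hc hc_symm hcomp hs (hs.trans_le hst) hst
  simp only at h1
  rw [costDeriv, costDeriv, Real.sqrt_le_left (by positivity), mul_pow,
    Real.sq_sqrt (hx.costDerivSq_nonneg hφ hc hc_symm hcomp hs)]
  have e1 : Real.exp (-lam * (t - s)) ^ 2
      = Real.exp (-(2 * lam * t)) * Real.exp (2 * lam * s) := by
    rw [← Real.exp_nat_mul, ← Real.exp_add]; push_cast; ring_nf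
  have h2 := mul_le_mul_of_nonneg_left h1 (Real.exp_pos (-(2 * lam * t))).le
  rw [← mul_assoc, ← Real.exp_add, neg_add_cancel, Real.exp_zero, one_mul] at h2
  rw [e1]; linarith

theorem costDeriv_le_sqrt_div (hx : IsEVI lam c φ x) (hφ : IsProperEnergy φ)
    (hc : IsDissipative c) (hc_symm : ∀ y z, c y z = c z y) (hcomp : IsCompatible c φ)
    {z : X} (hz : IsMinimizer φ z) {s t : ℝ} (hs : 0 < s) (hst : s < t) :
    costDeriv c x t ≤ √(2 * c z (x s)) / expInt lam (t - s) := by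
  have hE := expInt_pos lam (sub_pos.2 hst)
  have h1 := hx.a_priori_estimate hφ hc hc_symm hcomp (hz.ne_top hφ) hs hst.le
  have h2 : (φ z).toReal ≤ energyAlong φ x t :=
    hz.toReal_le hφ (hx.energy_ne_top hφ (hs.trans hst))
  have h3 := mul_nonpos_of_nonneg_of_nonpos hE.le (sub_nonpos.2 h2)
  have h4 := mul_nonneg (Real.exp_pos (lam * (t - s))).le (hc.nonneg z (x t))
  rw [le_div_iff₀ hE]
  refine Real.le_sqrt_of_sq_le ?_
  rw [mul_pow, costDeriv, Real.sq_sqrt (hx.costDerivSq_nonneg hφ hc hc_symm hcomp (hs.trans hst))]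
  linarith

/-- A cluster point `z` minimizes the energy, so `c z (x t)` is non-increasing; continuity of `c`
makes it small at some time, hence infinitesimal. -/
theorem exists_tendsto_minimizer (hx : IsEVI 0 c φ x) (hφ : IsProperEnergy φ)
    (hc : IsDissipative c) (hcomp : IsCompatible c φ) (hcpt : CompactSublevels φ)
    (hcont : Continuous fun p : X × X => c p.1 p.2) :
    ∃ z, IsMinimizer φ z ∧ Tendsto x atTop (𝓝 z) := by
  obtain ⟨z, hz⟩ := hx.exists_mapClusterPt_of_compactSublevels hφ hc hcpt
  have hmin := hx.isMinimizer_of_mapClusterPt hφ hc hcomp le_rfl hz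
  refine ⟨z, hmin, hx.tendsto_of_tendsto_cost hφ hc hcomp ?_⟩
  have hcz : Tendsto (fun y => c z y) (𝓝 z) (𝓝 0) := by
    have h1 : Continuous fun y => c z y := hcont.comp (by fun_prop : Continuous fun y => (z, y))
    simpa [(hc.eq_zero_iff z z).2 rfl] using h1.tendsto z
  refine tendsto_order.2 ⟨fun a ha => Eventually.of_forall fun t => ha.trans_le (hc.nonneg _ _),
    fun a ha => ?_⟩
  obtain ⟨s, hsa, hs⟩ := ((hz.frequently (hcz.eventually (gt_mem_nhds ha))).and_eventually
    (eventually_gt_atTop 0)).exists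
  filter_upwards [eventually_ge_atTop s] with t ht
  have h1 := hx.exp_mul_cost_minimizer_le hφ hmin hs ht
  rw [zero_mul, Real.exp_zero, one_mul] at h1
  exact h1.trans_lt hsa

end

end IsEVI

end CostEVI

theorem theorem2p7 {X : Type*} [TopologicalSpace X] (lam : ℝ) (c : X → X → ℝ) (φ : X → EReal)
    (hφ_bot : ∀ y, φ y ≠ ⊥) (hφ_proper : ∃ y, φ y ≠ ⊤)
    (hc_symm : ∀ y z, c y z = c z y) (hc : CostEVI.IsDissipative c)
    (hcomp : CostEVI.IsCompatible c φ)
    (x : ℝ → X) (hx : CostEVI.IsEVI lam c φ x)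
    (hc_cont : lam < 0 → CostEVI.SeparatelyContinuous c) :
    -- `lam`-contraction
    (∀ x' : ℝ → X, CostEVI.IsEVI lam c φ x' → ∀ s t : ℝ, 0 < s → s ≤ t →
      c (x t) (x' t) ≤ Real.exp (-2 * lam * (t - s)) * c (x s) (x' s)) ∧
    -- energy identity
    (∀ t : ℝ, 0 < t → φ (x t) ≠ ⊤ ∧
      CostEVI.HasCostDerivSq c x t (CostEVI.costDerivSq c x t) ∧
      HasDerivWithinAt (CostEVI.energyAlong φ x) (-CostEVI.costDerivSq c x t) (Set.Ioi t) t) ∧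
    -- regularizing effect
    AntitoneOn (fun t : ℝ => Real.exp (2 * lam * t) * CostEVI.costDerivSq c x t) (Set.Ioi 0) ∧
    ContinuousOn (CostEVI.energyAlong φ x) (Set.Ioi 0) ∧
    (0 ≤ lam → ConvexOn ℝ (Set.Ioi 0) (CostEVI.energyAlong φ x)) ∧
    (lam < 0 → CostEVI.LocallySemiconvexOnPos (CostEVI.energyAlong φ x)) ∧
    (∃ T : Set ℝ, T ⊆ Set.Ioi 0 ∧ T.Countable ∧
      ∀ t ∈ Set.Ioi (0 : ℝ) \ T, DifferentiableAt ℝ (CostEVI.energyAlong φ x) t) ∧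
    -- cost derivative and oriented local slope
    (∀ t : ℝ, 0 < t →
      ((CostEVI.costDeriv c x t : ℝ) : EReal) = CostEVI.slopeAlong c φ x t) ∧
    -- a priori estimate
    (∀ y : X, φ y ≠ ⊤ → ∀ s t : ℝ, 0 < s → s ≤ t →
      Real.exp (lam * (t - s)) * c y (x t) - c y (x s)
          + (CostEVI.expInt lam (t - s)) ^ 2 / 2 * CostEVI.costDerivSq c x t
        ≤ CostEVI.expInt lam (t - s) * ((φ y).toReal - (φ (x t)).toReal)) ∧
    -- asymptotic behaviour
    ((∃ m : ℝ, ∀ y, (m : EReal) ≤ φ y) →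
      (0 < lam → (CostEVI.IsCauchyCompatible c φ ∨ CostEVI.CompactSublevels φ) →
        ∃ z : X, CostEVI.IsMinimizer φ z ∧ (∀ z', CostEVI.IsMinimizer φ z' → z' = z) ∧
          ∀ t₀ t : ℝ, 0 < t₀ → t₀ < t →
            lam * c z (x t) ≤ (φ (x t)).toReal - (φ z).toReal ∧
            (φ (x t)).toReal - (φ z).toReal
              ≤ lam * c z (x t₀) / (Real.exp (lam * (t - t₀)) - 1) ∧
            c z (x t) ≤ c z (x t₀) * Real.exp (-2 * lam * (t - t₀))) ∧
      (lam = 0 → ∀ z : X, CostEVI.IsMinimizer φ z →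
        AntitoneOn (fun t : ℝ => c z (x t)) (Set.Ioi 0) ∧
          ∀ t₀ t : ℝ, 0 < t₀ → t₀ < t →
            (φ (x t)).toReal - (φ z).toReal ≤ c z (x t₀) / (t - t₀)) ∧
      (0 ≤ lam → ∀ z : X, CostEVI.IsMinimizer φ z →
        ∀ t₀ t : ℝ, 0 < t₀ → t₀ < t →
          2 * lam * ((φ (x t)).toReal - (φ z).toReal) ≤ CostEVI.costDerivSq c x t ∧
          CostEVI.costDeriv c x t ≤ CostEVI.costDeriv c x t₀ * Real.exp (-lam * (t - t₀)) ∧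
          CostEVI.costDeriv c x t ≤ √(2 * c z (x t₀)) / CostEVI.expInt lam (t - t₀)) ∧
      (lam = 0 → CostEVI.CompactSublevels φ → Continuous (fun p : X × X => c p.1 p.2) →
        ∃ z : X, CostEVI.IsMinimizer φ z ∧ Filter.Tendsto x Filter.atTop (𝓝 z))) := by
  have hφ : CostEVI.IsProperEnergy φ := ⟨hφ_bot, hφ_proper⟩
  have hconv := hx.intrinsicConvex hφ hc hc_symm hcomp
  have hanti := hx.antitoneOn_energy hφ hc
  refine ⟨fun x' hx' s t hs hst => hx.contraction hx' hφ hc hc_symm hs hst,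
    fun t ht => ⟨hx.energy_ne_top hφ ht, ?_, ?_⟩,
    hx.antitoneOn_exp_mul_costDerivSq hφ hc hc_symm hcomp,
    hx.continuousOn_energy hφ hc hc_symm hcomp,
    hconv.convexOn hanti, fun _ => hconv.locallySemiconvexOnPos hanti,
    hconv.exists_countable_differentiableAt,
    fun t ht => hx.costDeriv_eq_slopeAlong hφ hc hc_symm hcomp ht,
    fun y hy s t hs hst => hx.a_priori_estimate hφ hc hc_symm hcomp hy hs hst,
    fun hbdd => ⟨fun hlam hor => ?_, ?_, fun hlam z hz s t hs hst =>
      ⟨hx.two_mul_energy_sub_le hφ hc hc_symm hcomp hlam hz (hs.trans hst),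
        hx.costDeriv_le_mul_exp hφ hc hc_symm hcomp hs hst.le,
        hx.costDeriv_le_sqrt_div hφ hc hc_symm hcomp hz hs hst⟩, ?_⟩⟩
  · rw [hx.costDerivSq_eq hφ hc hc_symm hcomp ht]
    exact hx.hasCostDerivSq hφ hc hc_symm hcomp ht
  · rw [hx.costDerivSq_eq hφ hc hc_symm hcomp ht, neg_neg]
    exact hconv.hasDerivWithinAt ht
  · obtain ⟨z, hz⟩ : ∃ z, MapClusterPt z atTop x := hor.elim
      (hx.exists_mapClusterPt_of_isCauchyCompatible hφ hc hc_symm hlam hbdd)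
      (hx.exists_mapClusterPt_of_compactSublevels hφ hc)
    have hmin := hx.isMinimizer_of_mapClusterPt hφ hc hcomp hlam.le hz
    have := hcomp.hausdorff
    refine ⟨z, hmin, fun z' hz' => tendsto_nhds_unique
      (hx.tendsto_minimizer hφ hc hcomp hlam hz') (hx.tendsto_minimizer hφ hc hcomp hlam hmin),
      fun s t hs hst => ⟨hx.mul_cost_minimizer_le hφ hc hc_symm hcomp hlam hmin (hs.trans hst), ?_,
        hx.cost_minimizer_le_exp hφ hc hc_symm hcomp hlam hmin hs hst.le⟩⟩
    have h1 := hx.energy_le hφ hc (hmin.ne_top hφ) hs hst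
    rwa [CostEVI.expInt_eq_div hlam.ne', div_div_eq_mul_div, mul_comm] at h1
  · rintro rfl z hz
    refine ⟨fun s hs t _ hst => ?_, fun s t hs hst => ?_⟩
    · simpa using hx.exp_mul_cost_minimizer_le hφ hz hs hst
    · have h1 := hx.energy_le hφ hc (hz.ne_top hφ) hs hst
      rwa [CostEVI.expInt_zero_left] at h1
  · rintro rfl hcpt hcont
    exact hx.exists_tendsto_minimizer hφ hc hcomp hcpt hcont
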